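/- Let $1\le d\le n$ be integers. Let $I(d,n)$ be the set of sequences $\mathbf I=[i_1<\dots<i_d]$ in $\{1,\dots,n\}$, which is a finite bounded distributive lattice under the componentwise order, with componentwise maximum as join $\vee$ and componentwise minimum as meet $\wedge$. Let $\mathrm{Gr}_{d,n}\subset\mathbb P(\Lambda^d\mathbb C^n)$ be the Grassmannian of $d$-dimensional subspaces of $\mathbb C^n$ in its Plücker embedding $\operatorname{span}(v_1,\dots,v_d)\mapsto[v_1\wedge\dots\wedge v_d]$, let $R=\mathbb C[\mathrm{Gr}_{d,n}]=\bigoplus_{i\ge0}R_i$ be its homogeneous coordinate ring (the polynomial ring in the Plücker coordinates modulo the ideal generated by the homogeneous polynomials vanishing on $\mathrm{Gr}_{d,n}$), and let $p_{\mathbf I}\in R_1$ be the Plücker coordinate dual to $e_{i_1}\wedge\dots\wedge e_{i_d}$. In a finite distributive lattice, call $m$ join-irreducible if $m=a\vee b$ implies $m=a$ or $m=b$ (so the least element is join-irreducible). Let $\operatorname{Spec}(\ell)$ be the set of join-irreducible elements $m\le\ell$, and $\operatorname{maxSpec}(\ell)$ the set of maximal elements of $\operatorname{Spec}(\ell)$.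 **Proposition.** The ring $\mathbb C[\mathrm{Gr}_{d,n}]$ is governed by the lattice $I(d,n)$ via the map $\mathbf I\mapsto p_{\mathbf I}\in R_1$. That is, this map is injective; the standard monomials $p_{\mathbf K_1}\cdots p_{\mathbf K_r}$ with $r\ge0$ and $\mathbf K_1\ge\dots\ge\mathbf K_r$ form a $\mathbb C$-vector space basis of $R$; and for any two incomparable $\mathbf I,\mathbf J\in I(d,n)$ there is a unique expression $$p_{\mathbf I}p_{\mathbf J}=\sum_{\mathbf K_1\ge\mathbf K_2}a_{\mathbf K_1,\mathbf K_2}\,p_{\mathbf K_1}p_{\mathbf K_2},\qquad a_{\mathbf K_1,\mathbf K_2}\in\mathbb C,$$ and it satisfies: (a) $a_{\mathbf I\vee\mathbf J,\,\mathbf I\wedge\mathbf J}=1$; (b) if $(\mathbf K_1,\mathbf K_2)\ne(\mathbf I\vee\mathbf J,\mathbf I\wedge\mathbf J)$ and $a_{\mathbf K_1,\mathbf K_2}\ne0$, then for all $m_1\in\operatorname{maxSpec}(\mathbf I\vee\mathbf J)$ and $m_2\in\operatorname{maxSpec}(\mathbf I\wedge\mathbf J)$ with $m_1\ge m_2$ one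 of the following holds: 1. there is $h\in\operatorname{maxSpec}(\mathbf K_1)$ with $h>m_1$; 2. statement 1 does not hold, and there are $h\ne h'$ in $\operatorname{maxSpec}(\mathbf K_1)$ with $h=m_1$ and $h'>m_2$; 3. statements 1 and 2 do not hold, and there are $h\in\operatorname{maxSpec}(\mathbf K_1)$ and $h'\in\operatorname{maxSpec}(\mathbf K_2)$ with $h=m_1$ and $h'\ge m_2$. -/

import Mathlib

open scoped LinearAlgebra.Projectivization

/-! ### Finite distributive lattices -/

section Lattices

variable {L : Type*} [DistribLattice L]

/-- Join-irreducible elements. The least element of a lattice is join-irreducible here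
(unlike for Mathlib's `SupIrred`). -/
def IsJoinIrreducible (m : L) : Prop :=
  ∀ a b : L, m = a ⊔ b → m = a ∨ m = b

/-- `Spec ℓ`: the join-irreducible elements below `ℓ`. -/
def latticeSpec (l : L) : Set L :=
  {m | IsJoinIrreducible m ∧ m ≤ l}

/-- `maxSpec ℓ`: the maximal elements of `Spec ℓ`. -/
def maxSpec (l : L) : Set L :=
  {m | Maximal (fun x => x ∈ latticeSpec l) m}

/-- First alternative: some `h ∈ maxSpec k₁` satisfies `h > m₁`. -/
def SpecAltOne (k₁ m₁ : L) : Prop :=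
  ∃ h ∈ maxSpec k₁, m₁ < h

/-- Second alternative: the first fails, and there are `h ≠ h'` in `maxSpec k₁` such that
`h = m₁` and `h' > m₂`. -/
def SpecAltTwo (k₁ m₁ m₂ : L) : Prop :=
  ¬ SpecAltOne k₁ m₁ ∧
    ∃ h ∈ maxSpec k₁, ∃ h' ∈ maxSpec k₁, h ≠ h' ∧ h = m₁ ∧ m₂ < h'

/-- Third alternative: the first two fail, and there are `h ∈ maxSpec k₁`, `h' ∈ maxSpec k₂`
such that `h = m₁` and `h' ≥ m₂`. -/
def SpecAltThree (k₁ k₂ m₁ m₂ : L) : Prop :=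
  ¬ SpecAltOne k₁ m₁ ∧ ¬ SpecAltTwo k₁ m₁ m₂ ∧
    ∃ h ∈ maxSpec k₁, ∃ h' ∈ maxSpec k₂, h = m₁ ∧ m₂ ≤ h'

/-- The combinatorial condition on a pair `(k₁, k₂)` that occurs in the straightening relation of
the incomparable elements `l₁, l₂`. -/
def MaxSpecCondition (l₁ l₂ k₁ k₂ : L) : Prop :=
  ∀ m₁ ∈ maxSpec (l₁ ⊔ l₂), ∀ m₂ ∈ maxSpec (l₁ ⊓ l₂), m₂ ≤ m₁ →
    SpecAltOne k₁ m₁ ∨ SpecAltTwo k₁ m₁ m₂ ∨ SpecAltThree k₁ k₂ m₁ m₂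

/-- Weakly decreasing finite sequences `k₁ ≥ ⋯ ≥ k_r` in `L`, with `r ≥ 0`: the exponents of the
standard monomials. -/
abbrev StdSeq (L : Type*) [DistribLattice L] : Type _ :=
  {s : List L // s.Pairwise (fun a b => b ≤ a)}

/-- Pairs `(k₁, k₂)` with `k₁ ≥ k₂`. -/
abbrev StdPair (L : Type*) [DistribLattice L] : Type _ :=
  {k : L × L // k.2 ≤ k.1}

/-- The pair `(l₁ ∨ l₂, l₁ ∧ l₂)`. -/
def leadingPair (l₁ l₂ : L) : StdPair L :=
  ⟨(l₁ ⊔ l₂, l₁ ⊓ l₂), inf_le_sup⟩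

end Lattices

/-! ### Algebras governed by a lattice -/

/-- The standard monomial `x_{k₁} ⋯ x_{k_r}`, where `x_l = ψ l`. -/
def stdMonomial {L R : Type*} [DistribLattice L] [CommRing R] (ψ : L → R) (s : StdSeq L) : R :=
  (s.1.map ψ).prod

/-- `a` gives an expression of `x_{l₁} x_{l₂}` as a linear combination of standard monomials
`x_{k₁} x_{k₂}`, `k₁ ≥ k₂`. -/
def IsStraightening {L R : Type*} [DistribLattice L] [Finite L] [CommRing R] [Algebra ℂ R]
    (ψ : L → R) (l₁ l₂ : L) (a : StdPair L → ℂ) : Prop :=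
  ψ l₁ * ψ l₂ = ∑ᶠ k : StdPair L, a k • (ψ k.1.1 * ψ k.1.2)

/-- The graded algebra `R = ⨁ 𝒜 i` is governed by the finite distributive lattice `L`, by way of
the injective map `ψ : L → 𝒜 1`, `l ↦ x_l`. (A finite nonempty lattice is bounded.) -/
structure IsGovernedBy {L R : Type*} [DistribLattice L] [Finite L] [CommRing R] [Algebra ℂ R]
    (𝒜 : ℕ → Submodule ℂ R) [GradedAlgebra 𝒜] (ψ : L → R) : Prop where
  nonempty : Nonempty L
  mem_degree_one : ∀ l, ψ l ∈ 𝒜 1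
  injective : Function.Injective ψ
  linearIndependent : LinearIndependent ℂ (stdMonomial ψ)
  span_eq_top : Submodule.span ℂ (Set.range (stdMonomial ψ)) = ⊤
  straightening : ∀ l₁ l₂ : L, ¬ l₁ ≤ l₂ → ¬ l₂ ≤ l₁ →
    ∃ a : StdPair L → ℂ,
      IsStraightening ψ l₁ l₂ a ∧
      (∀ a', IsStraightening ψ l₁ l₂ a' → a' = a) ∧
      a (leadingPair l₁ l₂) = 1 ∧
      ∀ k : StdPair L, k ≠ leadingPair l₁ l₂ → a k ≠ 0 →
        MaxSpecCondition l₁ l₂ k.1.1 k.1.2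

/-! ### The lattice `I(d, n)` -/

/-- `I(d, n)`: strictly increasing sequences of length `d` in an `n`-element chain
(`Fin n = {0, …, n - 1}` in place of `{1, …, n}`). -/
@[ext]
structure GrIndex (d n : ℕ) where
  toEmb : Fin d ↪o Fin n

namespace GrIndex

variable {d n : ℕ}

theorem toFun_injective :
    Function.Injective (fun (I : GrIndex d n) (k : Fin d) => I.toEmb k) := by
  intro I J h
  ext k : 2
  exact congrFun h k

instance : Finite (GrIndex d n) := Finite.of_injective _ toFun_injective

/-- The order is the componentwise one. -/
instance : LE (GrIndex d n) := ⟨fun I J => ∀ k, I.toEmb k ≤ J.toEmb k⟩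

instance : LT (GrIndex d n) := ⟨fun I J => I ≤ J ∧ ¬ J ≤ I⟩

/-- The join is the componentwise maximum. -/
instance : Max (GrIndex d n) :=
  ⟨fun I J => ⟨OrderEmbedding.ofStrictMono (fun k => max (I.toEmb k) (J.toEmb k))
    fun _ _ h => max_lt_max (I.toEmb.strictMono h) (J.toEmb.strictMono h)⟩⟩

/-- The meet is the componentwise minimum. -/
instance : Min (GrIndex d n) :=
  ⟨fun I J => ⟨OrderEmbedding.ofStrictMono (fun k => min (I.toEmb k) (J.toEmb k))
    fun _ _ h => min_lt_min (I.toEmb.strictMono h) (J.toEmb.strictMono h)⟩⟩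

instance : DistribLattice (GrIndex d n) :=
  toFun_injective.distribLattice _ Iff.rfl
    (by
      intro I J
      exact Pi.lt_def.trans (by
        constructor
        · rintro ⟨h, i, hi⟩
          exact ⟨h, fun h' => absurd (h' i) (not_le.mpr hi)⟩
        · rintro ⟨h, h'⟩
          refine ⟨h, ?_⟩
          by_contra hc
          push Not at hc
          exact h' hc))
    (fun _ _ => rfl) (fun _ _ => rfl)

/-- Increasing sequences of length `d` correspond to subsets with `d` elements. -/
def equivPowersetCard : Set.powersetCard (Fin n) d ≃ GrIndex d n :=
  Set.powersetCard.ofFinEmbEquiv.symm.trans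
    ⟨fun f => ⟨f⟩, fun I => I.toEmb, fun _ => rfl, fun _ => rfl⟩

end GrIndex

/-! ### Homogeneous coordinate rings -/

section Quotient

variable {A : Type*} [CommRing A] [Algebra ℂ A]

/-- The degree `i` part of a quotient of a graded algebra: the image of the degree `i` part. -/
def quotientGrading (𝒜 : ℕ → Submodule ℂ A) (I : Ideal A) (i : ℕ) : Submodule ℂ (A ⧸ I) :=
  (𝒜 i).map (Ideal.Quotient.mkₐ ℂ I).toLinearMap

instance quotientGrading_gradedMonoid (𝒜 : ℕ → Submodule ℂ A) [GradedAlgebra 𝒜] (I : Ideal A) :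
    SetLike.GradedMonoid (quotientGrading 𝒜 I) where
  one_mem := ⟨1, SetLike.GradedOne.one_mem, map_one (Ideal.Quotient.mkₐ ℂ I)⟩
  mul_mem := by
    rintro i j _ _ ⟨x, hx, rfl⟩ ⟨y, hy, rfl⟩
    exact ⟨x * y, SetLike.GradedMul.mul_mem hx hy, map_mul (Ideal.Quotient.mkₐ ℂ I) x y⟩

theorem quotientGrading_isInternal (𝒜 : ℕ → Submodule ℂ A) [GradedAlgebra 𝒜] (I : Ideal A)
    (hI : I.IsHomogeneous 𝒜) : DirectSum.IsInternal (quotientGrading 𝒜 I) := by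
  let f : ∀ i, 𝒜 i →ₗ[ℂ] quotientGrading 𝒜 I i := fun i =>
    (Ideal.Quotient.mkₐ ℂ I).toLinearMap.restrict fun x hx => ⟨x, hx, rfl⟩
  have hf : ∀ i, Function.Surjective (f i) := by
    rintro i ⟨_, ⟨x, hx, rfl⟩⟩
    exact ⟨⟨x, hx⟩, rfl⟩
  have hcoe : ∀ y, DirectSum.coeLinearMap (quotientGrading 𝒜 I) (DirectSum.lmap f y) =
      Ideal.Quotient.mk I (DirectSum.coeLinearMap 𝒜 y) := by
    intro y
    induction y using DirectSum.induction_on with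
    | zero => simp
    | of i x =>
      rw [DirectSum.lmap_of]
      simp only [DirectSum.coeLinearMap_of]
      rfl
    | add x y hx hy => simp [map_add, hx, hy]
  constructor
  · intro x y hxy
    obtain ⟨x, rfl⟩ := (DirectSum.lmap_surjective f).mpr hf x
    obtain ⟨y, rfl⟩ := (DirectSum.lmap_surjective f).mpr hf y
    have h0 : Ideal.Quotient.mk I (DirectSum.coeLinearMap 𝒜 x) =
        Ideal.Quotient.mk I (DirectSum.coeLinearMap 𝒜 y) :=
      (hcoe x).symm.trans (hxy.trans (hcoe y))
    have h1 := (hI.mem_iff).mp (Ideal.Quotient.eq.mp h0)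
    have h3 : ∀ z, DirectSum.decompose 𝒜 (DirectSum.coeLinearMap 𝒜 z) = z :=
      DirectSum.Decomposition.right_inv
    refine (DirectSum.lmap_eq_iff f x y).mpr fun i => Subtype.ext ?_
    have h2 := h1 i
    rw [DirectSum.decompose_sub, h3, h3] at h2
    exact Ideal.Quotient.eq.mpr h2
  · intro r
    obtain ⟨a, rfl⟩ := Ideal.Quotient.mk_surjective r
    refine ⟨DirectSum.lmap f (DirectSum.decompose 𝒜 a), (hcoe _).trans ?_⟩
    exact congrArg _ (DirectSum.Decomposition.left_inv a)

end Quotient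

section HomogeneousCoordinateRing

attribute [local instance] MvPolynomial.gradedAlgebra

variable {σ V : Type*} [AddCommGroup V] [Module ℂ V]

/-- The homogeneous ideal of a set `X` of points of the projective space `ℙ(V)` (whose points are
the lines in `V`), with respect to the linear coordinates of `V` given by a basis: it is generated
by the homogeneous polynomials that vanish at all points of `X`. -/
noncomputable def homogeneousVanishingIdeal (b : Module.Basis σ ℂ V) (X : Set (ℙ ℂ V)) :
    Ideal (MvPolynomial σ ℂ) :=
  Ideal.span {f | (∃ m : ℕ, f.IsHomogeneous m) ∧
    ∀ (v : V) (hv : v ≠ 0), Projectivization.mk ℂ v hv ∈ X →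
      MvPolynomial.eval (fun s => b.coord s v) f = 0}

/-- The homogeneous coordinate ring of `X ⊆ ℙ(V)`. -/
abbrev HomogeneousCoordinateRing (b : Module.Basis σ ℂ V) (X : Set (ℙ ℂ V)) : Type _ :=
  MvPolynomial σ ℂ ⧸ homogeneousVanishingIdeal b X

/-- The grading `R = ⨁ R_i` of the homogeneous coordinate ring. -/
noncomputable def coordinateRingGrading (b : Module.Basis σ ℂ V) (X : Set (ℙ ℂ V)) :
    ℕ → Submodule ℂ (HomogeneousCoordinateRing b X) :=
  quotientGrading (MvPolynomial.homogeneousSubmodule σ ℂ) (homogeneousVanishingIdeal b X)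

theorem homogeneousVanishingIdeal_isHomogeneous (b : Module.Basis σ ℂ V) (X : Set (ℙ ℂ V)) :
    (homogeneousVanishingIdeal b X).IsHomogeneous (MvPolynomial.homogeneousSubmodule σ ℂ) := by
  apply Ideal.homogeneous_span
  rintro f ⟨⟨m, hm⟩, -⟩
  exact ⟨m, hm⟩

noncomputable instance coordinateRingGrading_gradedAlgebra (b : Module.Basis σ ℂ V)
    (X : Set (ℙ ℂ V)) : GradedAlgebra (coordinateRingGrading b X) :=
  haveI : SetLike.GradedMonoid (coordinateRingGrading b X) :=
    quotientGrading_gradedMonoid (MvPolynomial.homogeneousSubmodule σ ℂ)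
      (homogeneousVanishingIdeal b X)
  DirectSum.IsInternal.gradedAlgebra
    (quotientGrading_isInternal _ _ (homogeneousVanishingIdeal_isHomogeneous b X))

/-- The class in the homogeneous coordinate ring of a coordinate function. -/
noncomputable def coordinateClass (b : Module.Basis σ ℂ V) (X : Set (ℙ ℂ V)) (s : σ) :
    HomogeneousCoordinateRing b X :=
  Ideal.Quotient.mk _ (MvPolynomial.X s)

end HomogeneousCoordinateRing

/-! ### The Grassmannian in its Plücker embedding -/

/-- The Grassmannian: the set of `d`-dimensional subspaces of `ℂⁿ`. -/
abbrev Gr (d n : ℕ) : Type :=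
  {W : Submodule ℂ (Fin n → ℂ) // Module.finrank ℂ W = d}

section Plucker

variable {d n : ℕ}

/-- The vector `v₁ ∧ ⋯ ∧ v_d` of `Λ^d ℂⁿ`, for a basis `v` of a subspace `W` of `ℂⁿ`. -/
noncomputable def wedgeOfBasis (W : Submodule ℂ (Fin n → ℂ)) (v : Module.Basis (Fin d) ℂ W) :
    ⋀[ℂ]^d (Fin n → ℂ) :=
  exteriorPower.ιMulti ℂ d (fun i => (v i : Fin n → ℂ))

theorem wedgeOfBasis_ne_zero (W : Submodule ℂ (Fin n → ℂ)) (v : Module.Basis (Fin d) ℂ W) :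
    wedgeOfBasis W v ≠ 0 := by
  have h : LinearIndependent ℂ (fun i => (v i : Fin n → ℂ)) :=
    v.linearIndependent.map' W.subtype (Submodule.ker_subtype W)
  have h2 := (exteriorPower.ιMulti_family_linearIndependent_field (n := d) h).ne_zero
    (Set.powersetCard.ofFinEmbEquiv (RelEmbedding.refl _))
  simpa [exteriorPower.ιMulti_family, wedgeOfBasis, Function.comp_def] using h2

theorem wedgeOfBasis_eq_smul (W : Submodule ℂ (Fin n → ℂ)) (v w : Module.Basis (Fin d) ℂ W) :
    wedgeOfBasis W w = v.det w • wedgeOfBasis W v := by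
  have h : (exteriorPower.ιMulti ℂ d).compLinearMap W.subtype =
      (LinearMap.toSpanSingleton ℂ _ (wedgeOfBasis W v)).compAlternatingMap v.det := by
    refine Module.Basis.ext_alternating v fun s hs => ?_
    let e : Equiv.Perm (Fin d) := Equiv.ofBijective s (Finite.injective_iff_bijective.mp hs)
    have h1 : (fun i => v (s i)) = v ∘ e := rfl
    rw [h1, AlternatingMap.map_perm, AlternatingMap.map_perm]
    simp [wedgeOfBasis, Module.Basis.det_self]
  exact congrArg (fun f => f w) h

/-- The Plücker embedding `Gr_{d,n} → ℙ(Λ^d ℂⁿ)`, sending the span of linearly independent vectors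
`v₁, …, v_d` to the line `[v₁ ∧ ⋯ ∧ v_d]`. -/
noncomputable def pluckerEmbedding (W : Gr d n) : ℙ ℂ (⋀[ℂ]^d (Fin n → ℂ)) :=
  Projectivization.mk ℂ (wedgeOfBasis W.1 (Module.finBasisOfFinrankEq ℂ W.1 W.2))
    (wedgeOfBasis_ne_zero _ _)

/-- The Plücker embedding does not depend on the choice of the basis. -/
theorem pluckerEmbedding_eq (W : Gr d n) (v : Module.Basis (Fin d) ℂ W.1) :
    pluckerEmbedding W = Projectivization.mk ℂ (wedgeOfBasis W.1 v)
      (wedgeOfBasis_ne_zero _ _) :=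
  (Projectivization.mk_eq_mk_iff' ℂ _ _ _ _).mpr ⟨_, (wedgeOfBasis_eq_smul W.1 v _).symm⟩

end Plucker

/-- The basis `e_{i₁} ∧ ⋯ ∧ e_{i_d}` of `Λ^d ℂⁿ`, indexed by `I(d, n)`. Its dual basis consists of
the Plücker coordinates `p_I`. -/
noncomputable def pluckerBasis (d n : ℕ) : Module.Basis (GrIndex d n) ℂ (⋀[ℂ]^d (Fin n → ℂ)) :=
  ((Pi.basisFun ℂ (Fin n)).exteriorPower d).reindex GrIndex.equivPowersetCard

/-- The homogeneous coordinate ring `ℂ[Gr_{d,n}]` of the Grassmannian in its Plücker embedding. -/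
abbrev GrCoordinateRing (d n : ℕ) : Type :=
  HomogeneousCoordinateRing (pluckerBasis d n) (Set.range (pluckerEmbedding (d := d) (n := n)))

/-- The grading of `ℂ[Gr_{d,n}]`. -/
noncomputable abbrev grGrading (d n : ℕ) : ℕ → Submodule ℂ (GrCoordinateRing d n) :=
  coordinateRingGrading (pluckerBasis d n) (Set.range pluckerEmbedding)

/-- The Plücker coordinate `p_I`, as an element of `ℂ[Gr_{d,n}]`. -/
noncomputable def pluckerCoordinate (d n : ℕ) (I : GrIndex d n) : GrCoordinateRing d n :=
  coordinateClass (pluckerBasis d n) (Set.range pluckerEmbedding) I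

/-! Up to a common factor, the Plücker coordinates of a point of the Grassmannian are the maximal
minors of a `d × n` matrix, so everything is proved for minors and carried over to the ring.

Existence of straightening: choose `k` with `i_k < j_k`. Alternating over the first `k` columns of
`I` and the columns of `J` from position `k` on gives an alternating function of `d + 1` vectors in
`ℂ^d`, hence zero. Every term other than `p_I p_J` vanishes or, after sorting, has a strictly larger
first factor. Upward induction gives standard products with `K₁ ≥ I` and the same multiset of
entries as `(I, J)` (`minorFn_mul_mem_span_standard`).

Independence: for a lexicographic order the leading monomial of a generic minor is its diagonal
product, and a standard sequence can be read off from the product of its diagonals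
(`linearIndependent_stdMonomial_minorPoly`).

By uniqueness the expansions of `p_I p_J` and `p_J p_I` coincide, so `K₁ ≥ I ∨ J`. Evaluation at a
matrix of zeros and ones whose minor on `K` vanishes unless `K ≤ I ∨ J` isolates the leading pair
and gives coefficient 1 (`exists_isStraightening`). The inequality `K₁ ≥ I ∨ J` and equality of
contents already imply condition (b) (`maxSpecCondition_of_content`), because a join-irreducible is
determined by one of its entries. Finally, straightening an incomparable pair makes it more spread
out, so repeating it terminates and standard monomials span. -/

/-! ### The order of `I(d, n)` through counting functions; join-irreducibles and condition (b). -/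

namespace GrIndex

variable {d n : ℕ}

/-- The number of entries of a tuple that are less than `x`. -/
def countLT (u : Fin d → Fin n) (x : Fin n) : ℕ :=
  (Finset.univ.filter fun i => u i < x).card

theorem sup_apply (I J : GrIndex d n) (k : Fin d) :
    (I ⊔ J).toEmb k = max (I.toEmb k) (J.toEmb k) := rfl

theorem inf_apply (I J : GrIndex d n) (k : Fin d) :
    (I ⊓ J).toEmb k = min (I.toEmb k) (J.toEmb k) := rfl

theorem countLT_anti {I J : GrIndex d n} (h : I ≤ J) (x : Fin n) :
    countLT J.toEmb x ≤ countLT I.toEmb x :=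
  Finset.card_le_card fun i hi => by
    simp only [Finset.mem_filter, Finset.mem_univ, true_and] at hi ⊢
    exact (h i).trans_lt hi

theorem countLT_self (I : GrIndex d n) (k : Fin d) : countLT I.toEmb (I.toEmb k) = k := by
  have : (Finset.univ.filter fun i => I.toEmb i < I.toEmb k) = Finset.Iio k := by
    ext i; simp
  rw [countLT, this, Fin.card_Iio]

theorem lt_countLT {I : GrIndex d n} {k : Fin d} {x : Fin n} (h : I.toEmb k < x) :
    (k : ℕ) < countLT I.toEmb x := by
  have : Finset.Iic k ⊆ Finset.univ.filter fun i => I.toEmb i < x := by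
    intro i hi
    simp only [Finset.mem_filter, Finset.mem_univ, true_and, Finset.mem_Iic] at hi ⊢
    exact (I.toEmb.monotone hi).trans_lt h
  have := Finset.card_le_card this
  rw [Fin.card_Iic] at this
  exact this

/-- Counts ignore the order of the entries, so this form of the order can be tested on unsorted
tuples, and sums of counts record the content of a pair. -/
theorem le_iff_countLT {I J : GrIndex d n} :
    I ≤ J ↔ ∀ x, countLT J.toEmb x ≤ countLT I.toEmb x := by
  refine ⟨countLT_anti, fun h k => ?_⟩
  by_contra hk
  have h1 := lt_countLT (not_le.mp hk)
  have h2 := h (I.toEmb k)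
  rw [countLT_self] at h2
  omega

theorem countLT_sup_add_inf (I J : GrIndex d n) (x : Fin n) :
    countLT (I ⊔ J).toEmb x + countLT (I ⊓ J).toEmb x =
      countLT I.toEmb x + countLT J.toEmb x := by
  simp only [countLT, Finset.card_filter, ← Finset.sum_add_distrib]
  refine Finset.sum_congr rfl fun k _ => ?_
  rw [sup_apply, inf_apply]
  rcases le_total (I.toEmb k) (J.toEmb k) with h | h
  · rw [max_eq_right h, min_eq_left h, add_comm]
  · rw [max_eq_left h, min_eq_right h]

/-- Entries of an increasing sequence grow at least as fast as their positions. -/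
theorem apply_add_sub_le (I : GrIndex d n) {i j : Fin d} (h : i ≤ j) :
    (I.toEmb i : ℕ) + (j - i : ℕ) ≤ I.toEmb j := by
  obtain ⟨j, hj⟩ := j
  induction j with
  | zero =>
    have : i = ⟨0, hj⟩ := le_antisymm h (Nat.zero_le _)
    subst this; simp
  | succ j ih =>
    rcases h.lt_or_eq with h' | h'
    · have h1 := ih (by omega) (Nat.lt_succ_iff.mp h')
      have h2 : I.toEmb ⟨j, by omega⟩ < I.toEmb ⟨j + 1, hj⟩ :=
        I.toEmb.strictMono (Nat.lt_succ_self j)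
      have h3 : (i : ℕ) < j + 1 := h'
      rw [Fin.lt_def] at h2
      simp only at h1 ⊢
      omega
    · subst h'; simp

theorem val_le_apply (I : GrIndex d n) (i : Fin d) : (i : ℕ) ≤ I.toEmb i := by
  have h := I.apply_add_sub_le (i := ⟨0, i.pos⟩) (j := i) (Nat.zero_le _)
  simp only at h
  omega

theorem rect_aux (K : GrIndex d n) (r i : Fin d) :
    (if i < r then (i : ℕ) else K.toEmb r - r + i) ≤ K.toEmb i := by
  split_ifs with h
  · exact K.val_le_apply i
  · have h1 := K.apply_add_sub_le (not_lt.mp h)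
    have h2 := K.val_le_apply r
    rw [Fin.lt_def] at h
    omega

/-- The smallest element of `I(d, n)` whose entry in position `r` is the same as that of `K`.
The corresponding Young diagram is a rectangle. -/
def rect (K : GrIndex d n) (r : Fin d) : GrIndex d n :=
  ⟨OrderEmbedding.ofStrictMono
    (fun i => ⟨if i < r then (i : ℕ) else K.toEmb r - r + i,
      (K.rect_aux r i).trans_lt (K.toEmb i).2⟩)
    (by
      intro i j hij
      have := K.val_le_apply r
      simp only [Fin.lt_def] at hij ⊢
      split_ifs <;> omega)⟩

theorem rect_apply (K : GrIndex d n) (r i : Fin d) :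
    ((K.rect r).toEmb i : ℕ) = if i < r then (i : ℕ) else K.toEmb r - r + i := rfl

theorem rect_apply_self (K : GrIndex d n) (r : Fin d) : (K.rect r).toEmb r = K.toEmb r := by
  ext
  rw [rect_apply, if_neg (lt_irrefl r)]
  have := K.val_le_apply r
  omega

theorem rect_le_iff {K L : GrIndex d n} {r : Fin d} :
    K.rect r ≤ L ↔ K.toEmb r ≤ L.toEmb r := by
  refine ⟨fun h => K.rect_apply_self r ▸ h r, fun h i => ?_⟩
  rw [Fin.le_def, rect_apply]
  refine le_trans ?_ (L.rect_aux r i)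
  split_ifs
  · rfl
  · rw [Fin.le_def] at h
    omega

/-- Position `r` of a join is attained by one of the two elements, and by `rect_le_iff` this one
entry decides whether an element lies above the rectangle. -/
theorem isJoinIrreducible_rect (K : GrIndex d n) (r : Fin d) : IsJoinIrreducible (K.rect r) := by
  intro a b hab
  have h := congrArg (fun L => L.toEmb r) hab
  simp only [rect_apply_self, sup_apply] at h
  rcases max_choice (a.toEmb r) (b.toEmb r) with h' | h'
  · exact Or.inl (le_antisymm (rect_le_iff.mpr (h.trans h').le) (hab ▸ le_sup_left))
  · exact Or.inr (le_antisymm (rect_le_iff.mpr (h.trans h').le) (hab ▸ le_sup_right))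

end GrIndex

theorem IsJoinIrreducible.exists_eq_of_eq_sup' {L ι : Type*} [DistribLattice L] {m : L}
    (hm : IsJoinIrreducible m) {s : Finset ι} (hs : s.Nonempty) (f : ι → L)
    (h : m = s.sup' hs f) : ∃ i ∈ s, m = f i := by
  induction hs using Finset.Nonempty.cons_induction with
  | singleton a => exact ⟨a, Finset.mem_singleton_self a, by simpa using h⟩
  | cons a s ha hs ih =>
    rw [Finset.sup'_cons hs] at h
    rcases hm _ _ h with h' | h'
    · exact ⟨a, Finset.mem_cons_self a s, h'⟩
    · obtain ⟨i, hi, h''⟩ := ih h'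
      exact ⟨i, Finset.mem_cons_of_mem hi, h''⟩

theorem exists_maxSpec_ge {L : Type*} [DistribLattice L] [Finite L] {m k : L}
    (hm : m ∈ latticeSpec k) : ∃ h ∈ maxSpec k, m ≤ h := by
  obtain ⟨h, hmh, hh⟩ := (Set.toFinite (latticeSpec k)).exists_le_maximal hm
  exact ⟨h, hh, hmh⟩

namespace GrIndex

variable {d n : ℕ}

/-- Every element is the join of its rectangles `m.rect r` over all positions `r`. -/
theorem _root_.IsJoinIrreducible.exists_eq_rect {m : GrIndex d n} (hd : 1 ≤ d)
    (hm : IsJoinIrreducible m) : ∃ r, m = m.rect r := by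
  have hne : (Finset.univ : Finset (Fin d)).Nonempty := ⟨⟨0, hd⟩, Finset.mem_univ _⟩
  obtain ⟨r, -, hr⟩ := hm.exists_eq_of_eq_sup' hne m.rect (by
    refine le_antisymm (fun i => ?_) (Finset.sup'_le hne _ fun r _ => rect_le_iff.mpr le_rfl)
    have h : m.rect i ≤ Finset.univ.sup' hne m.rect := Finset.le_sup' m.rect (Finset.mem_univ i)
    exact (m.rect_apply_self i) ▸ h i)
  exact ⟨r, hr⟩

/-- If `K₁ ≥ I ∨ J` and `(K₁, K₂)` has the same content as `(I, J)`, then the combinatorial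
condition holds. -/
theorem maxSpecCondition_of_content (hd : 1 ≤ d) {I J K₁ K₂ : GrIndex d n} (h₁ : I ⊔ J ≤ K₁)
    (hc : ∀ x, countLT K₁.toEmb x + countLT K₂.toEmb x =
      countLT I.toEmb x + countLT J.toEmb x) :
    MaxSpecCondition I J K₁ K₂ := by
  intro m₁ hm₁ m₂ hm₂ _
  by_cases ha : SpecAltOne K₁ m₁
  · exact Or.inl ha
  by_cases hb : SpecAltTwo K₁ m₁ m₂
  · exact Or.inr (Or.inl hb)
  refine Or.inr (Or.inr ⟨ha, hb, ?_⟩)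
  -- Since `m₁ ≤ I ∨ J ≤ K₁`, failure of the first alternative makes `m₁` itself maximal in `Spec
  -- K₁`.
  obtain ⟨h, hh, hmh⟩ := exists_maxSpec_ge (k := K₁) ⟨hm₁.prop.1, hm₁.prop.2.trans h₁⟩
  obtain rfl : m₁ = h := by
    by_contra hne
    exact ha ⟨h, hh, lt_of_le_of_ne hmh hne⟩
  by_cases h2 : m₂ ≤ K₂
  · obtain ⟨h', hh', hmh'⟩ := exists_maxSpec_ge (k := K₂) ⟨hm₂.prop.1, h2⟩
    exact ⟨m₁, hh, h', hh', rfl, hmh'⟩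
  -- If `m₂` is not below `K₂`, the second alternative is shown to hold after all.
  refine absurd ⟨ha, m₁, hh, ?_⟩ hb
  obtain ⟨r, hr⟩ := hm₂.prop.1.exists_eq_rect hd
  have hrB : m₂.toEmb r ≤ (I ⊓ J).toEmb r := hm₂.prop.2 r
  set x := m₂.toEmb r with hx
  have hK₂ : K₂.toEmb r < x := by
    rw [hr, rect_le_iff, not_le] at h2
    exact h2
  -- `K₂` has more than `r` entries below `x` and `I ∧ J` at most `r`; equality of contents turns
  -- this surplus into a deficit for `K₁`.
  have hlt : countLT K₁.toEmb x < countLT (I ⊔ J).toEmb x := by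
    have e1 := lt_countLT hK₂
    have e2 := hc x
    have e3 := countLT_sup_add_inf I J x
    have e4 : countLT (I ⊓ J).toEmb x ≤ r := by
      by_contra hcon
      have : x ≤ (I ⊓ J).toEmb r := hrB
      have h5 : countLT (I ⊓ J).toEmb x ≤ countLT (I ⊓ J).toEmb ((I ⊓ J).toEmb r) :=
        Finset.card_le_card fun i hi => by
          simp only [Finset.mem_filter, Finset.mem_univ, true_and] at hi ⊢
          exact hi.trans_le this
      rw [countLT_self] at h5
      exact hcon h5
    omega
  obtain ⟨q, hq⟩ : ∃ q, (I ⊔ J).toEmb q < x ∧ x ≤ K₁.toEmb q := by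
    by_contra hcon
    push Not at hcon
    refine absurd hlt (not_lt.mpr (Finset.card_le_card fun i hi => ?_))
    simp only [Finset.mem_filter, Finset.mem_univ, true_and] at hi ⊢
    exact hcon i hi
  have hqr : q < r := by
    by_contra hcon
    have h3 : (I ⊔ J).toEmb r ≤ (I ⊔ J).toEmb q := (I ⊔ J).toEmb.monotone (not_lt.mp hcon)
    have h4 : (I ⊓ J).toEmb r ≤ (I ⊔ J).toEmb r := (inf_le_sup : I ⊓ J ≤ I ⊔ J) r
    exact absurd hq.1 (not_lt.mpr (hrB.trans (h4.trans h3)))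
  -- The witness lies above the rectangle of `K₁` at `q`. It differs from `m₁` because its entry at
  -- `q` exceeds that of `I ∨ J`.
  obtain ⟨h', hh', hgh'⟩ := exists_maxSpec_ge (k := K₁) (m := K₁.rect q)
    ⟨isJoinIrreducible_rect K₁ q, rect_le_iff.mpr le_rfl⟩
  have hqh' : K₁.toEmb q ≤ h'.toEmb q := rect_le_iff.mp hgh'
  refine ⟨h', hh', ?_, rfl, ?_⟩
  · rintro rfl
    have h5 : m₁.toEmb q ≤ (I ⊔ J).toEmb q := hm₁.prop.2 q
    exact absurd (hq.1.trans_le hq.2) (not_lt.mpr (hqh'.trans h5))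
  -- The rectangle has entry at least `x` at `q` and grows by one per position, so `q < r` makes the
  -- inequality at `r` strict.
  · have hrg : x < (K₁.rect q).toEmb r := by
      have h6 := hq.2
      have h7 := K₁.val_le_apply q
      rw [Fin.lt_def, rect_apply, if_neg hqr.le.not_gt]
      rw [Fin.le_def] at h6
      rw [Fin.lt_def] at hqr
      omega
    refine lt_of_lt_of_le (lt_of_le_of_ne ?_ ?_) hgh'
    · rw [hr, rect_le_iff]
      exact hrg.le
    · intro heq
      rw [← heq] at hrg
      exact lt_irrefl _ hrg

end GrIndex

/-! ### Exchange relations and straightening of products of two minors. -/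

/-- Fix some of the arguments of an alternating map. -/
def AlternatingMap.fixArguments {R V N ι : Type*} [CommRing R] [AddCommGroup V] [Module R V]
    [AddCommGroup N] [Module R N] (f : V [⋀^ι]→ₗ[R] N) (P : ι → Prop)
    [DecidablePred P] (z : {i // ¬ P i} → V) : V [⋀^{i // P i}]→ₗ[R] N :=
  { f.toMultilinearMap.domDomRestrict P z with
    map_eq_zero_of_eq' := fun v i j hv hij =>
      f.map_eq_zero_of_eq _ (i := i) (j := j) (by simpa [i.2, j.2] using hv)
        (fun h => hij (Subtype.ext h)) }

theorem AlternatingMap.fixArguments_apply {R V N ι : Type*} [CommRing R] [AddCommGroup V]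
    [Module R V] [AddCommGroup N] [Module R N] (f : V [⋀^ι]→ₗ[R] N) (P : ι → Prop)
    [DecidablePred P] (z : {i // ¬ P i} → V) (x : {i // P i} → V) :
    f.fixArguments P z x = f fun j => if h : P j then x ⟨j, h⟩ else z ⟨j, h⟩ := rfl

section Minors

variable {d n : ℕ}

/-- The maximal minor of a matrix on the columns `u`, as a function of the matrix. -/
noncomputable def minorFn (u : Fin d → Fin n) : Matrix (Fin d) (Fin n) ℂ → ℂ :=
  fun M => (M.submatrix id u).det

theorem detRowAlternating_columns (u : Fin d → Fin n) (M : Matrix (Fin d) (Fin n) ℂ) :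
    Matrix.detRowAlternating (fun i => M.transpose (u i)) = minorFn u M := by
  rw [minorFn, ← Matrix.det_transpose]
  rfl

/-- A minor with permuted columns vanishes or is, up to sign, a minor with increasing columns. -/
theorem minorFn_eq_zero_or_exists_sort (u : Fin d → Fin n) :
    minorFn u = 0 ∨ ∃ (K : GrIndex d n) (c : ℂ), minorFn u = c • minorFn K.toEmb ∧
      ∀ x, GrIndex.countLT K.toEmb x = GrIndex.countLT u x := by
  by_cases hu : Function.Injective u
  · right
    have hmono : StrictMono (u ∘ Tuple.sort u) :=
      (Tuple.monotone_sort u).strictMono_of_injective (hu.comp (Tuple.sort u).injective)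
    refine ⟨⟨OrderEmbedding.ofStrictMono _ hmono⟩,
      ((Equiv.Perm.sign (Tuple.sort u) : ℤ) : ℂ), ?_, fun x => ?_⟩
    · funext M
      have h := Matrix.det_permute' (Tuple.sort u) (M.submatrix id u)
      have h2 : ((Equiv.Perm.sign (Tuple.sort u) : ℤ) : ℂ) *
          ((Equiv.Perm.sign (Tuple.sort u) : ℤ) : ℂ) = 1 := by
        rw [← Int.cast_mul, ← Units.val_mul, Int.units_mul_self]; simp
      change (M.submatrix id u).det = _ * ((M.submatrix id u).submatrix id (Tuple.sort u)).det
      rw [h, ← mul_assoc, h2, one_mul]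
    · simp only [GrIndex.countLT, Finset.card_filter]
      exact Equiv.sum_comp (Tuple.sort u) (fun i => if u i < x then 1 else 0)
  · left
    funext M
    obtain ⟨i, j, hij, hne⟩ := Function.not_injective_iff.mp hu
    exact Matrix.det_zero_of_column_eq hne fun k => by simp [hij]

/-- The `d + 1` columns that are exchanged: the first ones of `I`, up to position `k`, and the last
ones of `J`, from position `k` on. -/
def exchangeColumns (I J : Fin d → Fin n) (k : Fin d) :
    {i : Fin d // i ≤ k} ⊕ {i : Fin d // k ≤ i} → Fin n :=
  Sum.elim (fun i => I i) (fun i => J i)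

theorem exchangeColumns_inr (I J : Fin d → Fin n) (k : Fin d) (i : {i : Fin d // k ≤ i}) :
    exchangeColumns I J k (Sum.inr i) = J i := rfl

/-- The columns in an exchange: the first tuple. -/
def exchangeFst (I : Fin d → Fin n) (k : Fin d) (w : {i : Fin d // i ≤ k} → Fin n) :
    Fin d → Fin n :=
  fun i => if h : i ≤ k then w ⟨i, h⟩ else I i

/-- The columns in an exchange: the second tuple. -/
def exchangeSnd (J : Fin d → Fin n) (k : Fin d) (w : {i : Fin d // k ≤ i} → Fin n) :
    Fin d → Fin n :=
  fun i => if h : k ≤ i then w ⟨i, h⟩ else J i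

theorem exchange_card (k : Fin d) :
    Fintype.card ({i : Fin d // i ≤ k} ⊕ {i : Fin d // k ≤ i}) = d + 1 := by
  rw [Fintype.card_sum, Fintype.card_subtype, Fintype.card_subtype]
  have h1 : (Finset.univ.filter fun i => i ≤ k) = Finset.Iic k := by ext; simp
  have h2 : (Finset.univ.filter fun i => k ≤ i) = Finset.Ici k := by ext; simp
  rw [h1, h2, Fin.card_Iic, Fin.card_Ici]
  omega

/-- The exchange relation between maximal minors. -/
theorem minorFn_mul_mem_span_exchange (I J : Fin d → Fin n) (k : Fin d) :
    minorFn I * minorFn J ∈ Submodule.span ℂ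
      {f | ∃ σ : Equiv.Perm ({i : Fin d // i ≤ k} ⊕ {i : Fin d // k ≤ i}),
        σ ∉ (Equiv.Perm.sumCongrHom _ _).range ∧
        f = minorFn (exchangeFst I k fun i => exchangeColumns I J k
              (σ (Sum.inl i))) *
            minorFn (exchangeSnd J k fun i => exchangeColumns I J k
              (σ (Sum.inr i)))} := by
  classical
  let w : {i : Fin d // i ≤ k} ⊕ {i : Fin d // k ≤ i} → Fin n :=
    exchangeColumns I J k
  let a (M : Matrix (Fin d) (Fin n) ℂ) : (Fin d → ℂ) [⋀^{i : Fin d // i ≤ k}]→ₗ[ℂ] ℂ :=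
    Matrix.detRowAlternating.fixArguments (fun i => i ≤ k) fun i => M.transpose (I i)
  let b (M : Matrix (Fin d) (Fin n) ℂ) : (Fin d → ℂ) [⋀^{i : Fin d // k ≤ i}]→ₗ[ℂ] ℂ :=
    Matrix.detRowAlternating.fixArguments (fun i => k ≤ i) fun i => M.transpose (J i)
  -- The sum runs over cosets modulo permutations preserving the two blocks, so each shuffle of the
  -- exchanged columns occurs once, up to sign.
  let T (q : Equiv.Perm.ModSumCongr {i : Fin d // i ≤ k} {i : Fin d // k ≤ i}) :
      Matrix (Fin d) (Fin n) ℂ → ℂ := fun M =>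
    LinearMap.mul' ℂ ℂ (AlternatingMap.domCoprod.summand (a M) (b M) q
      fun y => M.transpose (w y))
  have ha (M) (x : {i : Fin d // i ≤ k} → Fin n) :
      a M (fun i => M.transpose (x i)) = minorFn (exchangeFst I k x) M := by
    rw [← detRowAlternating_columns, AlternatingMap.fixArguments_apply]
    congr 1
    funext j
    simp only [exchangeFst]
    split_ifs <;> rfl
  have hb (M) (x : {i : Fin d // k ≤ i} → Fin n) :
      b M (fun i => M.transpose (x i)) = minorFn (exchangeSnd J k x) M := by
    rw [← detRowAlternating_columns, AlternatingMap.fixArguments_apply]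
    congr 1
    funext j
    simp only [exchangeSnd]
    split_ifs <;> rfl
  have hT (σ : Equiv.Perm ({i : Fin d // i ≤ k} ⊕ {i : Fin d // k ≤ i})) :
      T (Quotient.mk'' σ) = ((Equiv.Perm.sign σ : ℤ) : ℂ) •
        (minorFn (exchangeFst I k fun i => w (σ (Sum.inl i))) *
          minorFn (exchangeSnd J k fun i => w (σ (Sum.inr i)))) := by
    funext M
    simp only [T, AlternatingMap.domCoprod.summand_mk'', Pi.smul_apply, Pi.mul_apply, smul_eq_mul]
    rw [← ha, ← hb, smul_apply, LinearMap.map_smul_of_tower,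
      MultilinearMap.domDomCongr_apply, MultilinearMap.domCoprod_apply, LinearMap.mul'_apply,
      Units.smul_def, zsmul_eq_mul]
    rfl
  have hsum : ∑ q, T q = 0 := by
    funext M
    -- An alternating map vanishes on dependent arguments, and `d + 1` vectors of `ℂ^d` are
    -- dependent.
    have h0 : (a M).domCoprod (b M) (fun y => M.transpose (w y)) = 0 := by
      refine AlternatingMap.map_linearDependent _ _ fun hli => ?_
      have := hli.fintype_card_le_finrank
      rw [exchange_card, Module.finrank_fin_fun] at this
      omega
    rw [AlternatingMap.domCoprod_apply, sum_apply] at h0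
    rw [Finset.sum_apply, ← map_sum, h0, map_zero]
    rfl
  -- The trivial coset contributes the original product, which is then isolated.
  let τ : Equiv.Perm ({i : Fin d // i ≤ k} ⊕ {i : Fin d // k ≤ i}) := 1
  have h1 : T (Quotient.mk'' τ) = minorFn I * minorFn J := by
    have e1 : (exchangeFst I k fun i => w (τ (Sum.inl i))) = I := by
      funext i; simp [exchangeFst, w, exchangeColumns, τ]
    have e2 : (exchangeSnd J k fun i => w (τ (Sum.inr i))) = J := by
      funext i; simp [exchangeSnd, w, exchangeColumns, τ]
    rw [hT, e1, e2]
    simp [τ]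
  rw [← Finset.add_sum_erase Finset.univ T (Finset.mem_univ (Quotient.mk'' τ)), h1] at hsum
  rw [eq_neg_of_add_eq_zero_left hsum]
  refine Submodule.neg_mem _ (Submodule.sum_mem _ fun q hq => ?_)
  induction q using Quotient.inductionOn' with | _ σ
  rw [hT]
  refine Submodule.smul_mem _ _ (Submodule.subset_span ⟨σ, fun hσ => ?_, rfl⟩)
  refine (Finset.mem_erase.mp hq).1 (Quotient.sound' ?_)
  rw [QuotientGroup.leftRel_apply, mul_one]
  exact inv_mem hσ

theorem countLT_exchangeFst (I : Fin d → Fin n) (k : Fin d)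
    (w : {i : Fin d // i ≤ k} → Fin n) (x : Fin n) :
    GrIndex.countLT (exchangeFst I k w) x =
      (Finset.univ.filter fun i => w i < x).card +
        (Finset.univ.filter fun i : {i : Fin d // ¬ i ≤ k} => I i < x).card := by
  simp only [GrIndex.countLT, Finset.card_filter]
  rw [← Fintype.sum_subtype_add_sum_subtype (fun i => i ≤ k)]
  congr 1
  · exact Finset.sum_congr rfl fun i _ => by simp [exchangeFst, i.2]
  · exact Finset.sum_congr rfl fun i _ => by simp only [exchangeFst, dif_neg i.2]

theorem countLT_exchangeSnd (J : Fin d → Fin n) (k : Fin d)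
    (w : {i : Fin d // k ≤ i} → Fin n) (x : Fin n) :
    GrIndex.countLT (exchangeSnd J k w) x =
      (Finset.univ.filter fun i => w i < x).card +
        (Finset.univ.filter fun i : {i : Fin d // ¬ k ≤ i} => J i < x).card := by
  simp only [GrIndex.countLT, Finset.card_filter]
  rw [← Fintype.sum_subtype_add_sum_subtype (fun i => k ≤ i)]
  congr 1
  · exact Finset.sum_congr rfl fun i _ => by simp [exchangeSnd, i.2]
  · exact Finset.sum_congr rfl fun i _ => by simp only [exchangeSnd, dif_neg i.2]

theorem exchangeFst_self (I : Fin d → Fin n) (k : Fin d) :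
    exchangeFst I k (fun i => I i) = I := by
  funext i; simp [exchangeFst]

theorem exchangeSnd_self (J : Fin d → Fin n) (k : Fin d) :
    exchangeSnd J k (fun i => J i) = J := by
  funext i; simp [exchangeSnd]

theorem countLT_exchange_add (I J : Fin d → Fin n) (k : Fin d)
    (σ : Equiv.Perm ({i : Fin d // i ≤ k} ⊕ {i : Fin d // k ≤ i})) (x : Fin n) :
    GrIndex.countLT (exchangeFst I k fun i => exchangeColumns I J k
        (σ (Sum.inl i))) x +
      GrIndex.countLT (exchangeSnd J k fun i => exchangeColumns I J k
        (σ (Sum.inr i))) x = GrIndex.countLT I x + GrIndex.countLT J x := by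
  have h1 := countLT_exchangeFst I k (fun i => I i) x
  have h2 := countLT_exchangeSnd J k (fun i => J i) x
  rw [exchangeFst_self] at h1
  rw [exchangeSnd_self] at h2
  rw [h1, h2, countLT_exchangeFst, countLT_exchangeSnd]
  have h3 : (∑ i, if exchangeColumns I J k (σ (Sum.inl i)) < x then 1 else 0) +
      (∑ i, if exchangeColumns I J k (σ (Sum.inr i)) < x then 1 else 0) =
      (∑ i : {i : Fin d // i ≤ k}, if I i < x then 1 else 0) +
        ∑ i : {i : Fin d // k ≤ i}, if J i < x then 1 else 0 := by
    have h := Equiv.sum_comp σ (fun y => if exchangeColumns I J k y < x then 1 else 0)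
    rw [Fintype.sum_sum_type, Fintype.sum_sum_type] at h
    exact h
  simp only [Finset.card_filter]
  omega

/-- The exchanged columns satisfy `i_1 < ⋯ < i_k < j_k < ⋯ < j_d`. For `x ≤ j_k` only columns coming
from `I` can count; for `x > j_k` all the replaced columns of `I` counted already. -/
theorem countLT_exchangeFst_le (I J : GrIndex d n) (k : Fin d) (hk : I.toEmb k < J.toEmb k)
    (σ : Equiv.Perm ({i : Fin d // i ≤ k} ⊕ {i : Fin d // k ≤ i})) (x : Fin n) :
    GrIndex.countLT (exchangeFst I.toEmb k fun i =>
      exchangeColumns I.toEmb J.toEmb k (σ (Sum.inl i))) x ≤ GrIndex.countLT I.toEmb x := by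
  have h1 := countLT_exchangeFst I.toEmb k (fun i => I.toEmb i) x
  rw [exchangeFst_self] at h1
  rw [h1, countLT_exchangeFst]
  refine Nat.add_le_add_right ?_ _
  rcases le_or_gt x (J.toEmb k) with hx | hx
  · have hinl : ∀ i : {i : Fin d // i ≤ k}, exchangeColumns I.toEmb J.toEmb k (σ (Sum.inl i)) < x →
        ∃ j, σ (Sum.inl i) = Sum.inl j ∧ I.toEmb j < x := by
      intro i hi
      rcases h : σ (Sum.inl i) with j | j
      · exact ⟨j, rfl, by simpa [h, exchangeColumns] using hi⟩
      · rw [h, exchangeColumns_inr] at hi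
        exact absurd (hi.trans_le (hx.trans (J.toEmb.monotone j.2))) (lt_irrefl _)
    -- The default `i` is never used on the filtered set, where `σ (Sum.inl i)` lies in the left
    -- block.
    refine Finset.card_le_card_of_injOn (fun i => ((σ (Sum.inl i)).getLeft?).getD i) ?_ ?_
    · intro i hi
      obtain ⟨j, hj, hjx⟩ := hinl i (by simpa using hi)
      simpa [hj] using hjx
    · intro i hi i' hi' h
      obtain ⟨j, hj, -⟩ := hinl i (by simpa using hi)
      obtain ⟨j', hj', -⟩ := hinl i' (by simpa using hi')
      simp only [hj, hj', Sum.getLeft?_inl, Option.getD_some] at h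
      subst h
      exact Sum.inl_injective (σ.injective (hj.trans hj'.symm))
  · refine Finset.card_le_card fun i _ => ?_
    simp only [Finset.mem_filter, Finset.mem_univ, true_and]
    exact (I.toEmb.monotone i.2).trans_lt (hk.trans hx)

/-- A permutation that does not preserve the blocks brings some `j_l ≥ j_k` into the first tuple,
where all the replaced entries were below `j_k`. -/
theorem countLT_exchangeFst_lt (I J : GrIndex d n) (k : Fin d) (hk : I.toEmb k < J.toEmb k)
    (σ : Equiv.Perm ({i : Fin d // i ≤ k} ⊕ {i : Fin d // k ≤ i}))
    (hσ : σ ∉ (Equiv.Perm.sumCongrHom _ _).range) :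
    GrIndex.countLT (exchangeFst I.toEmb k fun i =>
      exchangeColumns I.toEmb J.toEmb k (σ (Sum.inl i))) (J.toEmb k) <
      GrIndex.countLT I.toEmb (J.toEmb k) := by
  have h1 := countLT_exchangeFst I.toEmb k (fun i => I.toEmb i) (J.toEmb k)
  rw [exchangeFst_self] at h1
  rw [h1, countLT_exchangeFst]
  refine Nat.add_lt_add_right ?_ _
  obtain ⟨i, j, hij⟩ : ∃ i j, σ (Sum.inl i) = Sum.inr j := by
    by_contra hcon
    push Not at hcon
    refine hσ (Equiv.Perm.mem_sumCongrHom_range_of_perm_mapsTo_inl ?_)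
    rintro _ ⟨i, rfl⟩
    rcases h : σ (Sum.inl i) with j | j
    · exact ⟨j, rfl⟩
    · exact absurd h (hcon i j)
  have h2 : (Finset.univ.filter fun i : {i : Fin d // i ≤ k} => I.toEmb i < J.toEmb k) =
      Finset.univ := Finset.filter_true_of_mem fun i _ => (I.toEmb.monotone i.2).trans_lt hk
  rw [h2]
  refine Finset.card_lt_card (Finset.filter_ssubset.mpr ⟨i, Finset.mem_univ i, ?_⟩)
  rw [hij, exchangeColumns_inr, not_lt]
  exact J.toEmb.monotone j.2

/-- A product of two minors is a linear combination of the standard products `p_{K₁} p_{K₂}` with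
`K₁ ≥ I` and the same content as `(I, J)`. -/
theorem minorFn_mul_mem_span_standard (I J : GrIndex d n) :
    minorFn I.toEmb * minorFn J.toEmb ∈ Submodule.span ℂ
      ((fun k : StdPair (GrIndex d n) => minorFn k.1.1.toEmb * minorFn k.1.2.toEmb) ''
        {k | I ≤ k.1.1 ∧ ∀ x, GrIndex.countLT k.1.1.toEmb x + GrIndex.countLT k.1.2.toEmb x =
          GrIndex.countLT I.toEmb x + GrIndex.countLT J.toEmb x}) := by
  induction I using WellFoundedGT.induction generalizing J with | _ I ih
  by_cases hJI : J ≤ I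
  · exact Submodule.subset_span ⟨⟨(I, J), hJI⟩, ⟨le_rfl, fun _ => rfl⟩, rfl⟩
  obtain ⟨k, hk⟩ : ∃ k, I.toEmb k < J.toEmb k := by
    by_contra hcon
    push Not at hcon
    exact hJI hcon
  refine Submodule.span_le.mpr ?_ (minorFn_mul_mem_span_exchange I.toEmb J.toEmb k)
  rintro _ ⟨σ, hσ, rfl⟩
  rcases minorFn_eq_zero_or_exists_sort (exchangeFst I.toEmb k fun i =>
    exchangeColumns I.toEmb J.toEmb k (σ (Sum.inl i))) with h | ⟨K, c, hK, hKc⟩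
  · rw [h, zero_mul]; exact Submodule.zero_mem _
  rcases minorFn_eq_zero_or_exists_sort (exchangeSnd J.toEmb k fun i =>
    exchangeColumns I.toEmb J.toEmb k (σ (Sum.inr i))) with h | ⟨L, e, hL, hLc⟩
  · rw [h, mul_zero]; exact Submodule.zero_mem _
  rw [hK, hL, smul_mul_smul_comm]
  refine Submodule.smul_mem _ _ ?_
  have hIK : I < K := by
    refine lt_of_le_of_ne (GrIndex.le_iff_countLT.mpr fun x => ?_) ?_
    · rw [hKc]; exact countLT_exchangeFst_le I J k hk σ x
    · intro h
      have := countLT_exchangeFst_lt I J k hk σ hσ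
      rw [← hKc, ← h] at this
      exact lt_irrefl _ this
  have hcontent : ∀ x, GrIndex.countLT K.toEmb x + GrIndex.countLT L.toEmb x =
      GrIndex.countLT I.toEmb x + GrIndex.countLT J.toEmb x := fun x => by
    rw [hKc, hLc, countLT_exchange_add]
  refine Submodule.span_mono (Set.image_mono ?_) (ih K hIK L)
  rintro p ⟨hp1, hp2⟩
  exact ⟨hIK.le.trans hp1, fun x => (hp2 x).trans (hcontent x)⟩

end Minors

/-! ### Linear independence of standard monomials by leading terms. -/

section LeadingExponents

variable {σ ι : Type*} (m : MonomialOrder σ)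

/-- Polynomials with coefficient one at distinct leading exponents are linearly independent. -/
theorem MonomialOrder.linearIndependent_of_injective {R : Type*} [CommRing R]
    {f : ι → MvPolynomial σ R} {e : ι → σ →₀ ℕ} (he : Function.Injective e)
    (hdeg : ∀ i, m.toSyn (m.degree (f i)) ≤ m.toSyn (e i)) (hcoeff : ∀ i, (f i).coeff (e i) = 1) :
    LinearIndependent R f := by
  classical
  rw [linearIndependent_iff']
  intro s g hg
  by_contra hcon
  push Not at hcon
  obtain ⟨i₀, hi₀, hgi₀⟩ := hcon
  -- At the largest exponent occurring in a relation, only one term has a nonzero coefficient.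
  obtain ⟨i, hi, hmax⟩ := Finset.exists_max_image (s.filter fun i => g i ≠ 0)
    (fun i => m.toSyn (e i)) ⟨i₀, by simp [hi₀, hgi₀]⟩
  rw [Finset.mem_filter] at hi
  have h := congrArg (MvPolynomial.coeff (e i)) hg
  rw [MvPolynomial.coeff_sum, Finset.sum_eq_single i] at h
  · rw [MvPolynomial.coeff_smul, hcoeff, smul_eq_mul, mul_one] at h
    exact hi.2 h
  · intro j hj hji
    rw [MvPolynomial.coeff_smul, smul_eq_mul]
    by_cases hgj : g j = 0
    · rw [hgj, zero_mul]
    · rw [m.coeff_eq_zero_of_lt, mul_zero]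
      refine (hdeg j).trans_lt (lt_of_le_of_ne (hmax j (by simp [hj, hgj])) fun h' => hji ?_)
      exact he (m.toSyn.injective h')
  · exact fun h' => absurd hi.1 h'

end LeadingExponents

/-- At the smallest moved point both `σ` and its inverse must go up, since everything below is
fixed. -/
theorem Equiv.Perm.exists_first_moved {α : Type*} [LinearOrder α] [WellFoundedLT α]
    {σ : Equiv.Perm α} (hσ : σ ≠ 1) :
    ∃ k, k < σ k ∧ k < σ.symm k ∧ ∀ l < k, σ.symm l = l := by
  have hne : ∃ k, σ.symm k ≠ k := by
    by_contra hcon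
    push Not at hcon
    exact hσ (Equiv.ext fun k => by
      rw [Equiv.Perm.one_apply, ← σ.symm_apply_eq.mp (hcon k)])
  obtain ⟨k, hk⟩ := exists_minimal_of_wellFoundedLT (fun k => σ.symm k ≠ k) hne
  have hmin : ∀ l < k, σ.symm l = l := fun l hl => by
    by_contra hcon
    exact hk.not_prop_of_lt hl hcon
  refine ⟨k, lt_of_le_of_ne (not_lt.mp fun h => ?_) fun h => ?_,
    lt_of_le_of_ne (not_lt.mp fun h => ?_) hk.prop.symm, hmin⟩
  · have := hmin _ h
    rw [Equiv.symm_apply_apply] at this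
    exact absurd h (this ▸ lt_irrefl _)
  · exact hk.prop (σ.symm_apply_eq.mpr h)
  · exact hk.prop (σ.symm.injective (hmin _ h))

section MinorPolynomials

variable {d n : ℕ}

/-- The maximal minor on the columns `I` of the generic `d × n` matrix. -/
noncomputable def minorPoly (I : GrIndex d n) : MvPolynomial (Fin d ×ₗ Fin n) ℂ :=
  (Matrix.of fun k l => MvPolynomial.X (toLex (k, I.toEmb l))).det

/-- The exponent of the product of the entries in the positions `(σ k, i_k)`. -/
noncomputable def permExponent (I : GrIndex d n) (σ : Equiv.Perm (Fin d)) :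
    Fin d ×ₗ Fin n →₀ ℕ :=
  ∑ k, Finsupp.single (toLex (σ k, I.toEmb k)) 1

theorem permExponent_apply (I : GrIndex d n) (σ : Equiv.Perm (Fin d)) (k : Fin d) (c : Fin n) :
    permExponent I σ (toLex (k, c)) = if I.toEmb (σ.symm k) = c then 1 else 0 := by
  rw [permExponent, Finsupp.finsetSum_apply, Finset.sum_eq_single (σ.symm k)]
  · simp [Finsupp.single_apply]
  · intro l _ hl
    rw [Finsupp.single_apply, if_neg]
    intro h
    have h1 : σ l = k := congrArg (fun p => (ofLex p).1) h
    exact hl (by rw [← h1, Equiv.symm_apply_apply])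
  · exact fun h => absurd (Finset.mem_univ _) h

theorem minorPoly_eq_sum (I : GrIndex d n) :
    minorPoly I = ∑ σ : Equiv.Perm (Fin d),
      MvPolynomial.monomial (permExponent I σ) ((Equiv.Perm.sign σ : ℤ) : ℂ) := by
  rw [minorPoly, Matrix.det_apply']
  refine Finset.sum_congr rfl fun σ _ => ?_
  have h : ∏ k, MvPolynomial.X (R := ℂ) (toLex (σ k, I.toEmb k)) =
      MvPolynomial.monomial (permExponent I σ) 1 := by
    rw [permExponent, MvPolynomial.monomial_sum_one]
    rfl
  simp only [Matrix.of_apply]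
  rw [h, ← map_intCast (MvPolynomial.C (R := ℂ) (σ := Fin d ×ₗ Fin n)),
    MvPolynomial.C_mul_monomial, mul_one]

/-- Earlier variables weigh more. In the first row where `σ` leaves the diagonal it uses a column
further to the right, so it misses the variable `(k, i_k)`. -/
theorem permExponent_lt (I : GrIndex d n) {σ : Equiv.Perm (Fin d)} (hσ : σ ≠ 1) :
    MonomialOrder.lex.toSyn (permExponent I σ) < MonomialOrder.lex.toSyn (permExponent I 1) := by
  rw [MonomialOrder.lex_lt_iff, Finsupp.Lex.lt_iff]
  obtain ⟨k, -, hlt, hmin⟩ := Equiv.Perm.exists_first_moved hσ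
  refine ⟨toLex (k, I.toEmb k), ?_, ?_⟩
  · intro j hj
    obtain ⟨⟨l, c⟩, rfl⟩ := toLex.surjective j
    simp only [ofLex_toLex]
    rw [permExponent_apply, permExponent_apply]
    rcases Prod.Lex.toLex_lt_toLex.mp hj with h | ⟨h, h'⟩
    · rw [hmin l h]; rfl
    · simp only at h h'
      subst h
      rw [if_neg (h'.trans (I.toEmb.strictMono hlt)).ne', if_neg]
      exact h'.ne'
  · simp only [ofLex_toLex]
    rw [permExponent_apply, permExponent_apply, if_neg (I.toEmb.strictMono hlt).ne']
    simp [Equiv.Perm.one_def]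

theorem degree_minorPoly_le (I : GrIndex d n) :
    MonomialOrder.lex.toSyn (MonomialOrder.lex.degree (minorPoly I)) ≤
      MonomialOrder.lex.toSyn (permExponent I 1) := by
  rw [minorPoly_eq_sum, MonomialOrder.degree_le_iff]
  intro c hc
  obtain ⟨σ, -, hσ⟩ := Finset.mem_biUnion.mp (MvPolynomial.support_sum hc)
  have h := Finset.mem_singleton.mp (MvPolynomial.support_monomial_subset hσ)
  subst h
  by_cases h1 : σ = 1
  · rw [h1]
  · exact (permExponent_lt I h1).le

theorem coeff_minorPoly (I : GrIndex d n) : (minorPoly I).coeff (permExponent I 1) = 1 := by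
  rw [minorPoly_eq_sum, MvPolynomial.coeff_sum, Finset.sum_eq_single 1]
  · simp
  · intro σ _ hσ
    rw [MvPolynomial.coeff_monomial, if_neg]
    exact fun h => (permExponent_lt I hσ).ne (congrArg _ h)
  · exact fun h => absurd (Finset.mem_univ _) h

theorem leading_list_prod (s : List (GrIndex d n)) :
    MonomialOrder.lex.toSyn (MonomialOrder.lex.degree (s.map minorPoly).prod) ≤
      MonomialOrder.lex.toSyn (s.map fun I => permExponent I 1).sum ∧
    (s.map minorPoly).prod.coeff (s.map fun I => permExponent I 1).sum = 1 := by
  induction s with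
  | nil => simp
  | cons I s ih =>
    simp only [List.map_cons, List.prod_cons, List.sum_cons]
    refine ⟨MonomialOrder.degree_mul_le.trans ?_, ?_⟩
    · rw [map_add, map_add]
      exact add_le_add (degree_minorPoly_le I) ih.1
    · rw [MonomialOrder.coeff_mul_of_add_of_degree_le (degree_minorPoly_le I) ih.1,
        coeff_minorPoly, ih.2, mul_one]

theorem sum_permExponent_apply (s : List (GrIndex d n)) (k : Fin d) (c : Fin n) :
    (s.map fun I => permExponent I 1).sum (toLex (k, c)) =
      (s.map fun I => I.toEmb k).count c := by
  induction s with
  | nil => simp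
  | cons I s ih =>
    simp only [List.map_cons, List.sum_cons, Finsupp.add_apply, List.count_cons]
    rw [ih, permExponent_apply, add_comm]
    congr 1
    by_cases h : I.toEmb k = c <;> simp [h, Equiv.Perm.one_def]

/-- Row `k` of the exponent records the multiset of `k`-th entries, and in a standard sequence these
are weakly decreasing, hence determined. Position 0 supplies the length. -/
theorem sum_permExponent_injective (hd : 1 ≤ d) :
    Function.Injective fun s : StdSeq (GrIndex d n) => (s.1.map fun I => permExponent I 1).sum := by
  intro s t h
  have hk : ∀ k : Fin d, (s.1.map fun I => I.toEmb k) = t.1.map fun I => I.toEmb k := by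
    intro k
    have hperm : (s.1.map fun I => I.toEmb k).Perm (t.1.map fun I => I.toEmb k) := by
      rw [List.perm_iff_count]
      intro c
      rw [← sum_permExponent_apply, ← sum_permExponent_apply]
      exact congrArg (fun f => f (toLex (k, c))) h
    have hs : ∀ u : StdSeq (GrIndex d n), (u.1.map fun I => I.toEmb k).Pairwise fun a b => b ≤ a :=
      fun u => List.pairwise_map.mpr (u.2.imp fun hab => hab k)
    exact hperm.eq_of_pairwise (fun a b _ _ h1 h2 => le_antisymm h2 h1) (hs s) (hs t)
  have hlen : s.1.length = t.1.length := by
    simpa using congrArg List.length (hk ⟨0, hd⟩)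
  refine Subtype.ext (List.ext_getElem hlen fun i h1 h2 => ?_)
  refine GrIndex.toFun_injective (funext fun k => ?_)
  have := List.getElem_of_eq (hk k) (i := i) (by simpa using h1)
  simpa using this

/-- The standard monomials in the maximal minors of a generic matrix are linearly independent. -/
theorem linearIndependent_stdMonomial_minorPoly (hd : 1 ≤ d) :
    LinearIndependent ℂ (stdMonomial (minorPoly (d := d) (n := n))) :=
  MonomialOrder.lex.linearIndependent_of_injective (sum_permExponent_injective hd)
    (fun s => (leading_list_prod s.1).1) (fun s => (leading_list_prod s.1).2)

end MinorPolynomials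

/-! ### Minors of a test matrix that isolates the leading pair. -/

section LeadingCoefficient

variable {d n : ℕ}

theorem GrIndex.le_of_perm {K L : GrIndex d n} (σ : Equiv.Perm (Fin d))
    (h : ∀ i, K.toEmb i ≤ L.toEmb (σ i)) : K ≤ L := by
  rw [GrIndex.le_iff_countLT]
  intro x
  calc GrIndex.countLT L.toEmb x
      = (Finset.univ.filter fun i => L.toEmb (σ i) < x).card := by
        simp only [GrIndex.countLT, Finset.card_filter]
        exact (Equiv.sum_comp σ fun i => if L.toEmb i < x then 1 else 0).symm
    _ ≤ _ := Finset.card_le_card fun i hi => by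
        simp only [Finset.mem_filter, Finset.mem_univ, true_and] at hi ⊢
        exact (h i).trans_lt hi

/-- The matrix with entries one in the positions `(k, i_k)` and `(k, j_k)` and zero elsewhere. -/
def twoPathMatrix (I J : GrIndex d n) : Matrix (Fin d) (Fin n) ℂ :=
  Matrix.of fun k i => if i = I.toEmb k ∨ i = J.toEmb k then 1 else 0

theorem twoPathMatrix_ne_zero {I J : GrIndex d n} {k : Fin d} {i : Fin n}
    (h : twoPathMatrix I J k i ≠ 0) : i = I.toEmb k ∨ i = J.toEmb k := by
  by_contra hcon
  exact h (if_neg hcon)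

theorem le_sup_of_minorFn_twoPathMatrix_ne_zero {I J K : GrIndex d n}
    (h : minorFn K.toEmb (twoPathMatrix I J) ≠ 0) : K ≤ I ⊔ J := by
  rw [minorFn, Matrix.det_apply'] at h
  obtain ⟨σ, -, hσ⟩ := Finset.exists_ne_zero_of_sum_ne_zero h
  have hσ' := Finset.prod_ne_zero_iff.mp (right_ne_zero_of_mul hσ)
  refine GrIndex.le_of_perm σ fun i => ?_
  rw [GrIndex.sup_apply]
  rcases twoPathMatrix_ne_zero (hσ' i (Finset.mem_univ i)) with h | h
  · exact le_max_of_le_left h.le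
  · exact le_max_of_le_right h.le

theorem minorFn_twoPathMatrix_eq_one {I J K : GrIndex d n}
    (hK : ∀ k, K.toEmb k = I.toEmb k ∨ K.toEmb k = J.toEmb k)
    (h : ∀ σ : Equiv.Perm (Fin d), σ ≠ 1 →
      (∀ k, K.toEmb k = I.toEmb (σ k) ∨ K.toEmb k = J.toEmb (σ k)) → False) :
    minorFn K.toEmb (twoPathMatrix I J) = 1 := by
  rw [minorFn, Matrix.det_apply', Finset.sum_eq_single 1]
  · rw [Finset.prod_eq_one]
    · simp
    · exact fun k _ => if_pos (hK k)
  · intro σ _ hσ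
    by_contra hcon
    have hσ' := Finset.prod_ne_zero_iff.mp (right_ne_zero_of_mul hcon)
    exact h σ hσ fun k => twoPathMatrix_ne_zero (hσ' k (Finset.mem_univ k))
  · exact fun h => absurd (Finset.mem_univ _) h

/-- A second nonzero term, with first moved point `k`, would give `i_k = j_{σ k}` and `i_{σ⁻¹ k} =
j_k`. As `σ⁻¹ k > k`, this forces `σ k < k`, a contradiction. -/
theorem minorFn_twoPathMatrix_left (I J : GrIndex d n) :
    minorFn I.toEmb (twoPathMatrix I J) = 1 := by
  refine minorFn_twoPathMatrix_eq_one (fun _ => Or.inl rfl) fun σ hσ h => ?_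
  obtain ⟨k, hk, hk', -⟩ := Equiv.Perm.exists_first_moved hσ
  have h1 : I.toEmb k = J.toEmb (σ k) :=
    (h k).resolve_left fun e => hk.ne (I.toEmb.injective e)
  have h2 : I.toEmb (σ.symm k) = J.toEmb k := by
    have := h (σ.symm k)
    rw [Equiv.apply_symm_apply] at this
    exact this.resolve_left fun e => hk'.ne' (I.toEmb.injective e)
  have h3 := I.toEmb.strictMono hk'
  rw [h1, h2] at h3
  exact lt_asymm hk (J.toEmb.lt_iff_lt.mp h3)

theorem twoPathMatrix_comm (I J : GrIndex d n) : twoPathMatrix I J = twoPathMatrix J I := by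
  ext k i
  simp only [twoPathMatrix, Matrix.of_apply, or_comm]

theorem minorFn_twoPathMatrix_right (I J : GrIndex d n) :
    minorFn J.toEmb (twoPathMatrix I J) = 1 := by
  rw [twoPathMatrix_comm, minorFn_twoPathMatrix_left]

theorem minorFn_twoPathMatrix_sup (I J : GrIndex d n) :
    minorFn (I ⊔ J).toEmb (twoPathMatrix I J) = 1 := by
  refine minorFn_twoPathMatrix_eq_one (fun k => max_choice _ _) fun σ hσ h => ?_
  obtain ⟨k, -, hk', -⟩ := Equiv.Perm.exists_first_moved hσ
  have h1 := h (σ.symm k)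
  rw [Equiv.apply_symm_apply] at h1
  have h2 : (I ⊔ J).toEmb (σ.symm k) ≤ (I ⊔ J).toEmb k := by
    rcases h1 with h1 | h1 <;> rw [h1, GrIndex.sup_apply]
    exacts [le_max_left _ _, le_max_right _ _]
  exact absurd ((I ⊔ J).toEmb.strictMono hk') (not_lt.mpr h2)

theorem minorFn_twoPathMatrix_inf (I J : GrIndex d n) :
    minorFn (I ⊓ J).toEmb (twoPathMatrix I J) = 1 := by
  refine minorFn_twoPathMatrix_eq_one (fun k => min_choice _ _) fun σ hσ h => ?_
  obtain ⟨k, hk, -⟩ := Equiv.Perm.exists_first_moved hσ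
  have h2 : (I ⊓ J).toEmb (σ k) ≤ (I ⊓ J).toEmb k := by
    rcases h k with h1 | h1 <;> rw [h1, GrIndex.inf_apply]
    exacts [min_le_left _ _, min_le_right _ _]
  exact absurd ((I ⊓ J).toEmb.strictMono hk) (not_lt.mpr h2)

end LeadingCoefficient

/-! ### Passage between minors and the homogeneous coordinate ring. -/

section CoordinateRing

variable {d n : ℕ}

theorem pluckerBasis_coord_ιMulti (K : GrIndex d n) (v : Fin d → Fin n → ℂ) :
    (pluckerBasis d n).coord K (exteriorPower.ιMulti ℂ d v) = minorFn K.toEmb (Matrix.of v) := by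
  rw [pluckerBasis, Module.Basis.coord_apply, Module.Basis.repr_reindex,
    Finsupp.mapDomain_equiv_apply, exteriorPower.basis_repr_apply,
    exteriorPower.ιMultiDual_apply_ιMulti, minorFn]
  congr 1
  ext i j
  have h : Set.powersetCard.ofFinEmbEquiv.symm (GrIndex.equivPowersetCard.symm K) = K.toEmb := by
    simp [GrIndex.equivPowersetCard]
  simp [h]

/-- Points of the Grassmannian have maximal minors as coordinates. -/
theorem exists_coord_eq_of_mem_range {v : ⋀[ℂ]^d (Fin n → ℂ)} (hv : v ≠ 0)
    (h : Projectivization.mk ℂ v hv ∈ Set.range (pluckerEmbedding (d := d) (n := n))) :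
    ∃ (c : ℂ) (M : Matrix (Fin d) (Fin n) ℂ),
      ∀ K, (pluckerBasis d n).coord K v = c * minorFn K.toEmb M := by
  obtain ⟨W, hW⟩ := h
  obtain ⟨c, hc⟩ := (Projectivization.mk_eq_mk_iff' ℂ _ _ _ _).mp hW.symm
  refine ⟨c, Matrix.of fun i => (Module.finBasisOfFinrankEq ℂ W.1 W.2 i : Fin n → ℂ), fun K => ?_⟩
  rw [← hc, map_smul, smul_eq_mul, wedgeOfBasis, pluckerBasis_coord_ιMulti]

/-- The maximal minors of a matrix of full rank are the coordinates of a point of the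
Grassmannian. -/
theorem exists_mem_range_coord_eq {I : GrIndex d n} {M : Matrix (Fin d) (Fin n) ℂ}
    (hM : minorFn I.toEmb M ≠ 0) :
    ∃ (v : ⋀[ℂ]^d (Fin n → ℂ)) (hv : v ≠ 0),
      Projectivization.mk ℂ v hv ∈ Set.range (pluckerEmbedding (d := d) (n := n)) ∧
      ∀ K, (pluckerBasis d n).coord K v = minorFn K.toEmb M := by
  have hli : LinearIndependent ℂ (fun i => M i) := by
    have h1 : LinearIndependent ℂ (M.submatrix id I.toEmb).row :=
      Matrix.linearIndependent_rows_of_det_ne_zero hM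
    exact LinearIndependent.of_comp (LinearMap.funLeft ℂ ℂ I.toEmb) h1
  let b := Module.Basis.span hli
  let W : Gr d n := ⟨Submodule.span ℂ (Set.range fun i => M i), by
    rw [finrank_span_eq_card hli, Fintype.card_fin]⟩
  refine ⟨wedgeOfBasis W.1 b, wedgeOfBasis_ne_zero _ _, ⟨W, pluckerEmbedding_eq W b⟩, fun K => ?_⟩
  rw [wedgeOfBasis, pluckerBasis_coord_ιMulti]
  congr 1
  ext i j
  simp only [Matrix.of_apply]
  exact congrFun (congrArg Subtype.val (Module.Basis.span_apply hli i)) j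

theorem eval_minorPoly (N : Fin d ×ₗ Fin n → ℂ) (K : GrIndex d n) :
    MvPolynomial.eval N (minorPoly K) =
      minorFn K.toEmb (Matrix.of fun k i => N (toLex (k, i))) := by
  rw [minorPoly, RingHom.map_det, minorFn]
  congr 1
  ext k l
  simp

theorem minorPoly_ne_zero (I : GrIndex d n) : minorPoly I ≠ 0 := fun h => by
  have := coeff_minorPoly I
  rw [h, MvPolynomial.coeff_zero] at this
  exact zero_ne_one this

theorem GrIndex.nonempty (hdn : d ≤ n) : Nonempty (GrIndex d n) :=
  ⟨⟨Fin.castLEOrderEmb hdn⟩⟩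

theorem aeval_minorPoly_eq_zero (hdn : d ≤ n) {f : MvPolynomial (GrIndex d n) ℂ}
    (hf : f ∈ homogeneousVanishingIdeal (pluckerBasis d n)
      (Set.range (pluckerEmbedding (d := d) (n := n)))) :
    MvPolynomial.aeval minorPoly f = 0 := by
  obtain ⟨I⟩ := GrIndex.nonempty hdn
  suffices h : homogeneousVanishingIdeal (pluckerBasis d n)
      (Set.range (pluckerEmbedding (d := d) (n := n))) ≤
      RingHom.ker (MvPolynomial.aeval (R := ℂ) (minorPoly (d := d) (n := n))) from h hf
  refine Ideal.span_le.mpr ?_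
  rintro g ⟨-, hg⟩
  rw [SetLike.mem_coe, RingHom.mem_ker]
  -- Only matrices of full rank give points of the Grassmannian. The factor `minorPoly I` makes the
  -- evaluation vanish where the minor on `I` does, and is cancelled in the domain afterwards.
  refine (mul_eq_zero.mp (?_ : minorPoly I * MvPolynomial.aeval minorPoly g = 0)).resolve_left
    (minorPoly_ne_zero I)
  refine MvPolynomial.funext fun N => ?_
  rw [map_mul, map_zero]
  by_cases hN : minorFn I.toEmb (Matrix.of fun k i => N (toLex (k, i))) = 0
  · rw [eval_minorPoly, hN, zero_mul]
  · obtain ⟨v, hv, hmem, hcoord⟩ := exists_mem_range_coord_eq hN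
    have h0 := hg v hv hmem
    have h1 : MvPolynomial.eval N (MvPolynomial.aeval minorPoly g) =
        MvPolynomial.eval (fun s => (pluckerBasis d n).coord s v) g := by
      rw [← MvPolynomial.coe_aeval_eq_eval, ← MvPolynomial.coe_aeval_eq_eval]
      simp only [RingHom.coe_coe]
      rw [← AlgHom.comp_apply, MvPolynomial.comp_aeval]
      congr 2
      funext K
      rw [hcoord, MvPolynomial.aeval_eq_eval, eval_minorPoly]
    rw [h1, h0, mul_zero]

/-- The homomorphism from the coordinate ring of the Grassmannian to the polynomial ring in the
entries of a generic matrix that sends Plücker coordinates to maximal minors. -/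
noncomputable def toMinorPoly (hdn : d ≤ n) :
    GrCoordinateRing d n →ₐ[ℂ] MvPolynomial (Fin d ×ₗ Fin n) ℂ :=
  Ideal.Quotient.liftₐ _ (MvPolynomial.aeval minorPoly) fun _ => aeval_minorPoly_eq_zero hdn

theorem toMinorPoly_pluckerCoordinate (hdn : d ≤ n) (K : GrIndex d n) :
    toMinorPoly hdn (pluckerCoordinate d n K) = minorPoly K := by
  refine (Ideal.Quotient.liftₐ_apply _ _ _ _).trans ?_
  exact (Ideal.Quotient.lift_mk _ _ _).trans (MvPolynomial.aeval_X _ _)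

theorem linearIndependent_stdMonomial_pluckerCoordinate (hd : 1 ≤ d) (hdn : d ≤ n) :
    LinearIndependent ℂ (stdMonomial (pluckerCoordinate d n)) := by
  have h : (toMinorPoly hdn).toLinearMap ∘ stdMonomial (pluckerCoordinate d n) =
      stdMonomial minorPoly := by
    funext s
    simp only [Function.comp_apply, stdMonomial, AlgHom.toLinearMap_apply, map_list_prod,
      List.map_map]
    congr 1
    exact List.map_congr_left fun K _ => toMinorPoly_pluckerCoordinate hdn K
  refine LinearIndependent.of_comp (toMinorPoly hdn).toLinearMap ?_
  rw [h]
  exact linearIndependent_stdMonomial_minorPoly hd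

/-- Quadratic relations between maximal minors are relations between Plücker coordinates. -/
theorem pluckerCoordinate_mul_eq_sum {ι : Type*} [Fintype ι] {I J : GrIndex d n} {a : ι → ℂ}
    {K L : ι → GrIndex d n}
    (h : minorFn I.toEmb * minorFn J.toEmb =
      ∑ k, a k • (minorFn (K k).toEmb * minorFn (L k).toEmb)) :
    pluckerCoordinate d n I * pluckerCoordinate d n J =
      ∑ k, a k • (pluckerCoordinate d n (K k) * pluckerCoordinate d n (L k)) := by
  let f : MvPolynomial (GrIndex d n) ℂ := MvPolynomial.X I * MvPolynomial.X J -
    ∑ k, a k • (MvPolynomial.X (K k) * MvPolynomial.X (L k))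
  have hX (I J : GrIndex d n) :
      (MvPolynomial.X I * MvPolynomial.X J : MvPolynomial _ ℂ).IsHomogeneous 2 :=
    (MvPolynomial.isHomogeneous_X ℂ I).mul (MvPolynomial.isHomogeneous_X ℂ J)
  have hf : f ∈ homogeneousVanishingIdeal (pluckerBasis d n)
      (Set.range (pluckerEmbedding (d := d) (n := n))) := by
    refine Ideal.subset_span ⟨⟨2, (hX I J).sub (MvPolynomial.IsHomogeneous.sum _ _ _ fun k _ => ?_)⟩,
      fun v hv hmem => ?_⟩
    · rw [MvPolynomial.smul_eq_C_mul]
      simpa using (MvPolynomial.isHomogeneous_C _ (a k)).mul (hX (K k) (L k))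
    · obtain ⟨c, M, hM⟩ := exists_coord_eq_of_mem_range hv hmem
      have h1 := congrFun h M
      simp only [Pi.mul_apply, Finset.sum_apply, Pi.smul_apply, smul_eq_mul] at h1
      simp only [f, map_sub, map_mul, map_sum, MvPolynomial.smul_eval, MvPolynomial.eval_X, hM]
      -- Both sides are quadratic, so the scalar `c` comes out as `c * c` everywhere.
      rw [mul_mul_mul_comm, h1, Finset.mul_sum, sub_eq_zero]
      exact Finset.sum_congr rfl fun k _ => by ring
  have h2 := Ideal.Quotient.eq_zero_iff_mem.mpr hf
  rw [map_sub, sub_eq_zero, map_mul, map_sum] at h2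
  refine h2.trans (Finset.sum_congr rfl fun k _ => ?_)
  rfl

end CoordinateRing

/-! ### Straightening relations, spanning, and the conclusion. -/

section Straightening

variable {d n : ℕ}

theorem exists_minorFn_mul_eq_sum [Fintype (StdPair (GrIndex d n))] (I J : GrIndex d n) :
    ∃ a : StdPair (GrIndex d n) → ℂ,
      minorFn I.toEmb * minorFn J.toEmb =
        ∑ k, a k • (minorFn k.1.1.toEmb * minorFn k.1.2.toEmb) ∧
      ∀ k, a k ≠ 0 → I ≤ k.1.1 ∧
        ∀ x, GrIndex.countLT k.1.1.toEmb x + GrIndex.countLT k.1.2.toEmb x =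
          GrIndex.countLT I.toEmb x + GrIndex.countLT J.toEmb x := by
  obtain ⟨l, hl, hsum⟩ := (Finsupp.mem_span_image_iff_linearCombination ℂ).mp
    (minorFn_mul_mem_span_standard I J)
  refine ⟨l, ?_, fun k hk => hl (Finsupp.mem_support_iff.mpr hk)⟩
  rw [← hsum, Finsupp.linearCombination_apply]
  exact Finsupp.sum_fintype _ _ fun _ => zero_smul _ _

/-- Pairs as sequences of length two. -/
def StdPair.toStdSeq {L : Type*} [DistribLattice L] (k : StdPair L) : StdSeq L :=
  ⟨[k.1.1, k.1.2], by simpa using k.2⟩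

theorem StdPair.toStdSeq_injective {L : Type*} [DistribLattice L] :
    Function.Injective (StdPair.toStdSeq (L := L)) := by
  intro k l h
  have h1 : [k.1.1, k.1.2] = [l.1.1, l.1.2] := congrArg Subtype.val h
  simp only [List.cons.injEq, and_true] at h1
  exact Subtype.ext (Prod.ext h1.1 h1.2)

theorem isStraightening_iff {L R : Type*} [DistribLattice L] [Finite L] [CommRing R] [Algebra ℂ R]
    [Fintype (StdPair L)] {ψ : L → R} {l₁ l₂ : L} {a : StdPair L → ℂ} :
    IsStraightening ψ l₁ l₂ a ↔ ψ l₁ * ψ l₂ = ∑ k, a k • (ψ k.1.1 * ψ k.1.2) := by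
  rw [IsStraightening, finsum_eq_sum_of_fintype]

theorem IsStraightening.unique {L R : Type*} [DistribLattice L] [Finite L] [CommRing R]
    [Algebra ℂ R] {ψ : L → R} (hψ : LinearIndependent ℂ (stdMonomial ψ)) {l₁ l₂ : L}
    {a b : StdPair L → ℂ} (ha : IsStraightening ψ l₁ l₂ a) (hb : IsStraightening ψ l₁ l₂ b) :
    a = b := by
  have := Fintype.ofFinite (StdPair L)
  rw [isStraightening_iff] at ha hb
  have hli := hψ.comp _ (StdPair.toStdSeq_injective (L := L))
  have hψ' : ∀ k : StdPair L, (stdMonomial ψ ∘ StdPair.toStdSeq) k = ψ k.1.1 * ψ k.1.2 := by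
    intro k
    simp [stdMonomial, StdPair.toStdSeq]
  have h := Fintype.linearIndependent_iff.mp hli (a - b) (by
    simp only [hψ', Pi.sub_apply, sub_smul, Finset.sum_sub_distrib]
    rw [← ha, ← hb, sub_self])
  exact funext fun k => sub_eq_zero.mp (h k)

theorem IsStraightening.symm {L R : Type*} [DistribLattice L] [Finite L] [CommRing R]
    [Algebra ℂ R] {ψ : L → R} {l₁ l₂ : L} {a : StdPair L → ℂ} (ha : IsStraightening ψ l₁ l₂ a) :
    IsStraightening ψ l₂ l₁ a := by
  rw [IsStraightening, mul_comm]
  exact ha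

/-- The first member and the content determine the counts of the second, and `(I ∨ J, I ∧ J)` has
the content of `(I, J)`. -/
theorem GrIndex.eq_leadingPair {I J : GrIndex d n} {k : StdPair (GrIndex d n)}
    (hk : k.1.1 = I ⊔ J)
    (hc : ∀ x, countLT k.1.1.toEmb x + countLT k.1.2.toEmb x =
      countLT I.toEmb x + countLT J.toEmb x) : k = leadingPair I J := by
  have h2 : ∀ x, countLT k.1.2.toEmb x = countLT (I ⊓ J).toEmb x := fun x => by
    have h1 := hc x
    rw [← countLT_sup_add_inf I J, hk] at h1
    omega
  refine Subtype.ext (Prod.ext hk (le_antisymm ?_ ?_))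
  · exact le_iff_countLT.mpr fun x => (h2 x).ge
  · exact le_iff_countLT.mpr fun x => (h2 x).le

/-- The straightening relations between Plücker coordinates. -/
theorem exists_isStraightening (hd : 1 ≤ d) (hdn : d ≤ n) (I J : GrIndex d n) :
    ∃ a : StdPair (GrIndex d n) → ℂ, IsStraightening (pluckerCoordinate d n) I J a ∧
      a (leadingPair I J) = 1 ∧
      ∀ k, a k ≠ 0 → I ⊔ J ≤ k.1.1 ∧
        ∀ x, GrIndex.countLT k.1.1.toEmb x + GrIndex.countLT k.1.2.toEmb x =
          GrIndex.countLT I.toEmb x + GrIndex.countLT J.toEmb x := by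
  have := Fintype.ofFinite (StdPair (GrIndex d n))
  obtain ⟨a, ha, ha'⟩ := exists_minorFn_mul_eq_sum I J
  obtain ⟨b, hb, hb'⟩ := exists_minorFn_mul_eq_sum J I
  have hsa : IsStraightening (pluckerCoordinate d n) I J a :=
    isStraightening_iff.mpr (pluckerCoordinate_mul_eq_sum ha)
  have hsb : IsStraightening (pluckerCoordinate d n) J I b :=
    isStraightening_iff.mpr (pluckerCoordinate_mul_eq_sum hb)
  -- The expansion of `p_I p_J` has `K₁ ≥ I`, that of `p_J p_I` has `K₁ ≥ J`; being equal, they have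
  -- both.
  obtain rfl := hsa.unique (linearIndependent_stdMonomial_pluckerCoordinate hd hdn) hsb.symm
  have hsupp : ∀ k, a k ≠ 0 → I ⊔ J ≤ k.1.1 := fun k hk => sup_le (ha' k hk).1 (hb' k hk).1
  refine ⟨a, hsa, ?_, fun k hk => ⟨hsupp k hk, (ha' k hk).2⟩⟩
  -- A surviving term needs `K₁ ≤ I ∨ J`, hence equality, hence the leading pair; the four minors
  -- involved are all 1.
  have h := congrFun ha (twoPathMatrix I J)
  rw [Finset.sum_apply, Finset.sum_eq_single (leadingPair I J)] at h
  · simp only [Pi.mul_apply, Pi.smul_apply, leadingPair, minorFn_twoPathMatrix_left,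
      minorFn_twoPathMatrix_right, minorFn_twoPathMatrix_sup, minorFn_twoPathMatrix_inf,
      smul_eq_mul, mul_one] at h
    exact h.symm
  · intro k _ hk
    by_contra hcon
    rw [Pi.smul_apply, Pi.mul_apply, smul_eq_mul] at hcon
    have h1 := left_ne_zero_of_mul hcon
    have h2 := left_ne_zero_of_mul (right_ne_zero_of_mul hcon)
    exact hk (GrIndex.eq_leadingPair
      (le_antisymm (le_sup_of_minorFn_twoPathMatrix_ne_zero h2) (hsupp k h1)) (ha' k h1).2)
  · exact fun h => absurd (Finset.mem_univ _) h

/-- Multisets of pairwise comparable elements are weakly decreasing sequences. -/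
theorem StdSeq.exists_coe_eq {L : Type*} [DistribLattice L] (s : Multiset L)
    (hs : ∀ a ∈ s, ∀ b ∈ s, a ≤ b ∨ b ≤ a) : ∃ t : StdSeq L, (t.1 : Multiset L) = s := by
  classical
  induction s using Multiset.strongInductionOn with | _ s ih
  by_cases h0 : s = 0
  · exact ⟨⟨[], List.Pairwise.nil⟩, h0 ▸ rfl⟩
  obtain ⟨m, hm⟩ := s.toFinset.exists_maximal (by
    obtain ⟨x, hx⟩ := Multiset.exists_mem_of_ne_zero h0
    exact ⟨x, Multiset.mem_toFinset.mpr hx⟩)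
  have hms : m ∈ s := Multiset.mem_toFinset.mp hm.prop
  obtain ⟨t, ht⟩ := ih (s.erase m) (Multiset.erase_lt.mpr hms) fun a ha b hb =>
    hs a (Multiset.mem_of_mem_erase ha) b (Multiset.mem_of_mem_erase hb)
  refine ⟨⟨m :: t.1, List.pairwise_cons.mpr ⟨fun x hx => ?_, t.2⟩⟩, ?_⟩
  · have hx' : x ∈ s := Multiset.mem_of_mem_erase (ht ▸ Multiset.mem_coe.mpr hx : x ∈ s.erase m)
    rcases hs x hx' m hms with h | h
    · exact h
    · exact hm.le_of_ge (Multiset.mem_toFinset.mpr hx') h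
  · rw [← Multiset.cons_coe, ht, Multiset.cons_erase hms]

/-- A strictly decreasing rank function on `I(d, n)`. -/
def GrIndex.corank (I : GrIndex d n) : ℕ := ∑ x, countLT I.toEmb x

theorem GrIndex.corank_lt {I K : GrIndex d n} (h : I < K) : K.corank < I.corank := by
  refine lt_of_le_of_ne (Finset.sum_le_sum fun x _ => countLT_anti h.le x) fun heq => ?_
  have h1 := (Finset.sum_eq_sum_iff_of_le fun x _ => countLT_anti h.le x).mp heq
  exact h.not_ge (le_iff_countLT.mpr fun x => (h1 x (Finset.mem_univ x)).ge)

theorem GrIndex.corank_le (I : GrIndex d n) : I.corank ≤ n * d := by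
  refine (Finset.sum_le_card_nsmul _ _ d fun x _ => ?_).trans (by simp)
  exact (Finset.card_le_univ _).trans (by simp)

/-- The sum of the squares of the coranks; it increases when a pair is straightened. -/
def GrIndex.energy (s : Multiset (GrIndex d n)) : ℕ := (s.map fun I => I.corank ^ 2).sum

theorem GrIndex.energy_le (s : Multiset (GrIndex d n)) :
    energy s ≤ s.card * (n * d) ^ 2 := by
  refine (Multiset.sum_le_card_nsmul _ ((n * d) ^ 2) ?_).trans (by simp)
  intro x hx
  obtain ⟨I, -, rfl⟩ := Multiset.mem_map.mp hx
  exact Nat.pow_le_pow_left I.corank_le 2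

theorem multiset_prod_mem_span_stdMonomial (hd : 1 ≤ d) (hdn : d ≤ n)
    (s : Multiset (GrIndex d n)) :
    (s.map (pluckerCoordinate d n)).prod ∈
      Submodule.span ℂ (Set.range (stdMonomial (pluckerCoordinate d n))) := by
  -- Straightening keeps the number of factors, so the energy has a fixed bound and the gap to it
  -- decreases.
  induction hN : s.card * (n * d) ^ 2 - GrIndex.energy s using Nat.strong_induction_on
    generalizing s with | _ N ih
  by_cases hs : ∀ a ∈ s, ∀ b ∈ s, a ≤ b ∨ b ≤ a
  · obtain ⟨t, rfl⟩ := StdSeq.exists_coe_eq s hs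
    rw [Multiset.map_coe, Multiset.prod_coe]
    exact Submodule.subset_span ⟨t, rfl⟩
  push Not at hs
  obtain ⟨I, hI, J, hJ, hIJ, hJI⟩ := hs
  obtain ⟨t', rfl⟩ := Multiset.exists_cons_of_mem hI
  obtain ⟨t, rfl⟩ := Multiset.exists_cons_of_mem
    ((Multiset.mem_cons.mp hJ).resolve_left fun h => hIJ h.ge)
  have := Fintype.ofFinite (StdPair (GrIndex d n))
  obtain ⟨a, ha, -, hsupp⟩ := exists_isStraightening hd hdn I J
  rw [isStraightening_iff] at ha
  rw [Multiset.map_cons, Multiset.map_cons, Multiset.prod_cons, Multiset.prod_cons, ← mul_assoc,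
    ha, Finset.sum_mul]
  refine Submodule.sum_mem _ fun k _ => ?_
  rw [smul_mul_assoc]
  by_cases hk : a k = 0
  · rw [hk, zero_smul]
    exact Submodule.zero_mem _
  refine Submodule.smul_mem _ _ ?_
  obtain ⟨hle, hc⟩ := hsupp k hk
  have h := ih _ ?_ (k.1.1 ::ₘ k.1.2 ::ₘ t) rfl
  · rwa [Multiset.map_cons, Multiset.map_cons, Multiset.prod_cons, Multiset.prod_cons,
      ← mul_assoc] at h
  have hI1 : k.1.1.corank < I.corank := GrIndex.corank_lt
    (lt_of_le_of_ne (le_sup_left.trans hle) fun h => hJI (h ▸ le_sup_right.trans hle))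
  have hJ1 : k.1.1.corank < J.corank := GrIndex.corank_lt
    (lt_of_le_of_ne (le_sup_right.trans hle) fun h => hIJ (h ▸ le_sup_left.trans hle))
  have hadd : k.1.1.corank + k.1.2.corank = I.corank + J.corank := by
    simp only [GrIndex.corank, ← Finset.sum_add_distrib]
    exact Finset.sum_congr rfl fun x _ => hc x
  -- The two coranks keep their sum while one drops below both old values, so the sum of squares
  -- grows.
  have henergy : GrIndex.energy (I ::ₘ J ::ₘ t) < GrIndex.energy (k.1.1 ::ₘ k.1.2 ::ₘ t) := by
    simp only [GrIndex.energy, Multiset.map_cons, Multiset.sum_cons]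
    nlinarith
  have hbound := GrIndex.energy_le (k.1.1 ::ₘ k.1.2 ::ₘ t)
  simp only [Multiset.card_cons] at hbound hN ⊢
  omega

theorem span_stdMonomial_pluckerCoordinate (hd : 1 ≤ d) (hdn : d ≤ n) :
    Submodule.span ℂ (Set.range (stdMonomial (pluckerCoordinate d n))) = ⊤ := by
  have hmul : ∀ K : GrIndex d n, ∀ y ∈ Submodule.span ℂ
      (Set.range fun s : Multiset (GrIndex d n) => (s.map (pluckerCoordinate d n)).prod),
      y * pluckerCoordinate d n K ∈ Submodule.span ℂ
        (Set.range fun s : Multiset (GrIndex d n) => (s.map (pluckerCoordinate d n)).prod) := by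
    intro K y hy
    induction hy using Submodule.span_induction with
    | mem x hx =>
      obtain ⟨s, rfl⟩ := hx
      refine Submodule.subset_span ⟨K ::ₘ s, ?_⟩
      simp only [Multiset.map_cons, Multiset.prod_cons]
      exact mul_comm _ _
    | zero => rw [zero_mul]; exact Submodule.zero_mem _
    | add x y _ _ hx hy => rw [add_mul]; exact Submodule.add_mem _ hx hy
    | smul c x _ hx => rw [smul_mul_assoc]; exact Submodule.smul_mem _ _ hx
  have h : ∀ f : MvPolynomial (GrIndex d n) ℂ,
      (Ideal.Quotient.mkₐ ℂ _ f : GrCoordinateRing d n) ∈ Submodule.span ℂ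
        (Set.range fun s : Multiset (GrIndex d n) => (s.map (pluckerCoordinate d n)).prod) := by
    intro f
    induction f using MvPolynomial.induction_on with
    | C a =>
      rw [← MvPolynomial.algebraMap_eq, AlgHom.commutes, Algebra.algebraMap_eq_smul_one]
      exact Submodule.smul_mem _ _ (Submodule.subset_span ⟨0, by simp⟩)
    | add f g hf hg =>
      rw [map_add]
      exact Submodule.add_mem _ hf hg
    | mul_X f K hf =>
      rw [map_mul]
      exact hmul K _ hf
  refine eq_top_iff.mpr fun x _ => ?_
  obtain ⟨f, rfl⟩ := Ideal.Quotient.mkₐ_surjective ℂ _ x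
  refine Submodule.span_le.mpr ?_ (h f)
  rintro _ ⟨s, rfl⟩
  exact multiset_prod_mem_span_stdMonomial hd hdn s

theorem pluckerCoordinate_injective (hd : 1 ≤ d) (hdn : d ≤ n) :
    Function.Injective (pluckerCoordinate d n) := by
  intro I J h
  have h1 := (linearIndependent_stdMonomial_pluckerCoordinate hd hdn).injective
    (a₁ := ⟨[I], List.pairwise_singleton _ _⟩) (a₂ := ⟨[J], List.pairwise_singleton _ _⟩)
    (by simpa [stdMonomial] using h)
  simpa using congrArg Subtype.val h1

end Straightening

theorem mainTheorem2 (d n : ℕ) (hd : 1 ≤ d) (hdn : d ≤ n) :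
    IsGovernedBy (grGrading d n) (pluckerCoordinate d n) where
  nonempty := GrIndex.nonempty hdn
  mem_degree_one K := ⟨MvPolynomial.X K, MvPolynomial.isHomogeneous_X ℂ K, rfl⟩
  injective := pluckerCoordinate_injective hd hdn
  linearIndependent := linearIndependent_stdMonomial_pluckerCoordinate hd hdn
  span_eq_top := span_stdMonomial_pluckerCoordinate hd hdn
  straightening I J _ _ := by
    obtain ⟨a, ha, hlead, hsupp⟩ := exists_isStraightening hd hdn I J
    exact ⟨a, ha,
      fun a' ha' => ha'.unique (linearIndependent_stdMonomial_pluckerCoordinate hd hdn) ha,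
      hlead, fun k _ hk => GrIndex.maxSpecCondition_of_content hd (hsupp k hk).1 (hsupp k hk).2⟩
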